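/- Throughout, $\tau\in\mathbb C$ with $\operatorname{Im}\tau>0$, $q^{x}:=e^{2\pi i x\tau}$ for $x\in\mathbb R$, $\eta$ is the Dedekind eta function, $\vartheta_{01}(\tau,z):=\sum_{j\in\mathbb Z}(-1)^j e^{2\pi i jz+\pi i j^2\tau}$ and $$\theta^{(\pm)}_{s,m}(\tau,z):=\sum_{j\in\mathbb Z}(\pm1)^j e^{2\pi i m(j+\frac{s}{2m})z}\,q^{m(j+\frac{s}{2m})^2},\qquad \theta_{s,m}:=\theta^{(+)}_{s,m}.$$ For a positive integer $m$ and integers $0\le n<2m$, $0\le \nu\le 2m$, $a,b$ put $$g^{[m]}_{n,\nu}(\tau):=\Big[\sum_{0<p\le j}-\sum_{j<p\le 0}\Big](-1)^j q^{(m+\frac12)\left(j+\nu-\frac{\nu+1/2}{2(m+1/2)}\right)^2-m\left(p+\nu-\frac{n}{2m}\right)^2},$$ $$h^{[m]}_{n,\nu}(\tau,z):=\sum_{j\in\mathbb Z}\frac{e^{2\pi i mjz+\pi i nz}q^{mj^2+n(j+\nu)}}{1-e^{2\pi i mz}q^{2m(j+\nu)}},$$ $$G^{[m]}_{n,\nu}(\tau,z):=g^{[m]}_{n,\nu}(\tau)\theta_{n,m}(\tau,z)+(-1)^\nu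 q^{-m\nu^2}\theta^{(-)}_{\nu+\frac12,m+\frac12}(\tau,0)\,h^{[m]}_{n,\nu}(\tau,z),$$ $$F^{[m](a,b)}_{n,\nu}(\tau,z):=e^{\pi i az}q^{\frac{a^2}{4m}}\,G^{[m]}_{n,\nu}\Big(\tau,z+\frac{a\tau}{m}+\frac bm\Big),$$ and, with all sums over $(j,k)\in\mathbb Z^2$, $$D^{[m]}_{n,\nu}(\tau):=\Big[\sum_{j>k\ge 0}-\sum_{j\le k<0}\Big]q^{m(j-\nu)^2-m\left(k-\nu+\frac{n}{2m}\right)^2}\quad(1\le n<2m),$$ $$D^{[m]}_{0,\nu}(\tau):=\nu+\Big[\sum_{j>k\ge 0}-\sum_{j<k<0}\Big]q^{m(j-\nu)^2-m(k-\nu)^2}.$$ **Proposition.** Let $m$ be a positive integer, $n$ an integer with $0\le n<2m$, and $\operatorname{Im}\tau>0$. Then the double series defining $g^{[m]}_{n',\nu'}(\tau)$ and $D^{[m]}_{n',\nu'}(\tau)$ converge absolutely for all $0\le n'<2m$, $0\le\nu'\le 2m$; the limit $$S_0(\tau):=\lim_{z\to0,\ z\ne0}\ \sum_{\nu'=0}^{2m}F^{[m](0,0)}_{0,\nu'}(\tau,z)$$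 exists (the individual terms may have poles at $z=0$, which cancel in the sum); and $$g^{[m]}_{n,m}\Big(-\frac1\tau\Big)=\frac{i\,(-1)^{m-1}\tau}{\sqrt{2m(2m+1)}}\cdot\frac{\eta(m\tau)^2\eta(4m\tau)^2}{\eta(2m\tau)^5}\Big(S_0(\tau)+\sum_{n'=1}^{2m-1}\sum_{\nu'=0}^{2m}e^{\frac{\pi i nn'}{m}}F^{[m](-n',0)}_{n',\nu'}(\tau,0)\Big)$$ $$=-\frac{i\,\tau}{\sqrt{2m(2m+1)}}\Big\{(-1)^m\sum_{n'=0}^{2m-1}\sum_{\nu'=0}^{2m}e^{\frac{\pi i nn'}{m}}g^{[m]}_{n',\nu'}(\tau)$$ $$\qquad+\frac{\eta(m\tau)^2\eta(4m\tau)^2}{\eta(2m\tau)^5}\sum_{n'=0}^{2m-1}\sum_{\nu'=0}^{2m}(-1)^{m+\nu'}e^{\frac{\pi i nn'}{m}}q^{\frac{(\nu'+1/2)^2}{4(m+1/2)}}\,\vartheta_{01}\big(2(m+\tfrac12)\tau,(\nu'+\tfrac12)\tau\big)\,D^{[m]}_{n',\nu'}(\tau)\Big\}.$$ -/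

import Mathlib

open Complex Filter Topology

noncomputable section

namespace IndefiniteModular

/-- `q ^ x = e ^ (2 π i τ x)` for a real exponent `x`. -/
def qPow (τ : ℂ) (x : ℝ) : ℂ :=
  cexp (2 * (Real.pi : ℂ) * I * τ * (x : ℂ))

/-- The theta function of degree `m` and characteristic `s` with sign `ε = ± 1`,
`∑_{j ∈ ℤ} ε ^ j e ^ (2 π i m (j + s / 2m) z) q ^ (m (j + s / 2m) ^ 2)`;
`ε = 1` gives `θ_{s,m}` and `ε = -1` gives `θ^{(-)}_{s,m}`. -/
def theta (ε : ℂ) (s m : ℝ) (τ z : ℂ) : ℂ :=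
  ∑' j : ℤ, ε ^ j *
    cexp (2 * (Real.pi : ℂ) * I * (m : ℂ) * ((j : ℂ) + (s : ℂ) / (2 * (m : ℂ))) * z) *
    qPow τ (m * ((j : ℝ) + s / (2 * m)) ^ 2)

/-- Mumford's theta function
`ϑ_{01}(τ, z) = ∑_{j ∈ ℤ} (-1) ^ j e ^ (π i j ^ 2 τ + 2 π i j z)`. -/
def vartheta01 (τ z : ℂ) : ℂ :=
  jacobiTheta₂ (z + 1 / 2) τ

/-- The summand of the indefinite series `g^{[m]}_{n,ν}`, at the index `(j, p)`. -/
def gTerm (m : ℝ) (n ν : ℤ) (τ : ℂ) (x : ℤ × ℤ) : ℂ :=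
  (-1 : ℂ) ^ x.1 *
    qPow τ
      ((m + 1 / 2) * ((x.1 : ℝ) + (ν : ℝ) - ((ν : ℝ) + 1 / 2) / (2 * (m + 1 / 2))) ^ 2
        - m * ((x.2 : ℝ) + (ν : ℝ) - (n : ℝ) / (2 * m)) ^ 2)

/-- The cone `0 < p ≤ j`. -/
def gPos : Set (ℤ × ℤ) := {x | 0 < x.2 ∧ x.2 ≤ x.1}

/-- The cone `j < p ≤ 0`. -/
def gNeg : Set (ℤ × ℤ) := {x | x.1 < x.2 ∧ x.2 ≤ 0}

/-- The function `g^{[m]}_{n,ν}(τ)`. -/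
def g (m : ℝ) (n ν : ℤ) (τ : ℂ) : ℂ :=
  (∑' x : gPos, gTerm m n ν τ x) - ∑' x : gNeg, gTerm m n ν τ x

/-- The function `h^{[m]}_{n,ν}(τ, z)`. -/
def h (m : ℝ) (n ν : ℤ) (τ z : ℂ) : ℂ :=
  ∑' j : ℤ,
    (cexp (2 * (Real.pi : ℂ) * I * (m : ℂ) * (j : ℂ) * z
        + (Real.pi : ℂ) * I * (n : ℂ) * z) *
      qPow τ (m * (j : ℝ) ^ 2 + (n : ℝ) * ((j : ℝ) + (ν : ℝ)))) /
    (1 - cexp (2 * (Real.pi : ℂ) * I * (m : ℂ) * z) *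
      qPow τ (2 * m * ((j : ℝ) + (ν : ℝ))))

/-- The function `G^{[m]}_{n,ν}(τ, z)`. -/
def G (m : ℝ) (n ν : ℤ) (τ z : ℂ) : ℂ :=
  g m n ν τ * theta 1 (n : ℝ) m τ z
    + (-1 : ℂ) ^ ν * qPow τ (-m * (ν : ℝ) ^ 2) *
      theta (-1) ((ν : ℝ) + 1 / 2) (m + 1 / 2) τ 0 * h m n ν τ z

/-- The function `F^{[m](a,b)}_{n,ν}(τ, z)`. -/
def F (m : ℝ) (a b n ν : ℤ) (τ z : ℂ) : ℂ :=
  cexp ((Real.pi : ℂ) * I * (a : ℂ) * z) * qPow τ ((a : ℝ) ^ 2 / (4 * m)) *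
    G m n ν τ (z + (a : ℂ) * τ / (m : ℂ) + (b : ℂ) / (m : ℂ))

/-- The term `q ^ (m (j - ν) ^ 2 - m (k - ν + n / 2m) ^ 2)` at the index `(j, k)`. -/
def dTerm (m : ℝ) (n ν : ℤ) (τ : ℂ) (x : ℤ × ℤ) : ℂ :=
  qPow τ
    (m * ((x.1 : ℝ) - (ν : ℝ)) ^ 2
      - m * ((x.2 : ℝ) - (ν : ℝ) + (n : ℝ) / (2 * m)) ^ 2)

/-- The cone `j > k ≥ 0`. -/
def dPos : Set (ℤ × ℤ) := {x | x.2 < x.1 ∧ 0 ≤ x.2}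

/-- The cone `j ≤ k < 0` when `n ≠ 0`, and `j < k < 0` when `n = 0`: for `n = 0` the terms
on the diagonal `j = k` are all equal to `1`. -/
def dNeg (n : ℤ) : Set (ℤ × ℤ) :=
  {x | x.1 ≤ x.2 ∧ x.2 < 0 ∧ (n = 0 → x.1 ≠ x.2)}

/-- The indefinite double sum `D^{[m]}_{n,ν}(τ)`. For `n = 0` the diagonal contributes the
finite number `ν`. -/
def D (m : ℝ) (n ν : ℤ) (τ : ℂ) : ℂ :=
  (∑' x : dPos, dTerm m n ν τ x) - (∑' x : dNeg n, dTerm m n ν τ x)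
    + if n = 0 then (ν : ℂ) else 0

end IndefiniteModular

end

namespace IndefiniteModular

/-! The indefinite series g enters through `G`, and `G` turns out to be built from ordinary theta
functions. By `G_eq_sum_thetaQuot`, G_{n,ν}(τ,z) is a discrete Fourier component, over the shifts z
- b/m with 0 ≤ b < 2m, of the quotient `thetaQuot`: a theta function of degree m + 1/2 in Z times
the reciprocal, up to a constant, of the odd Jacobi theta function at Z/2. The proof telescopes g
against h (`hNorm_sub`), which turns G into a single series over J of normalized functions h.
Partial fractions (`hNorm_eq_sum`) then replace these by Appell sums. Summing those over J with the
order exchanged factors out the reciprocal theta function, because an Appell sum with another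
integer parameter changes only by a power of u (`appell_eq`).

Inversion is now elementary. The numerator with ν = m is the odd theta function at (2m+1)τ, and the
alternating sum of all 2m+1 numerators is the odd theta function at τ/(2m+1). Since -(2m+1)/τ =
-1/(τ/(2m+1)), the map τ ↦ -1/τ carries the quotient with ν = m at -1/τ to the sum of all quotients
at τ (`thetaQuot_neg_one_div`). Also G_{n,m} = g_{n,m} θ_{n,m}, since the theta constant multiplying
h is an odd function at 0. Inversion exchanges the shifts by b/m and kτ/m, so a Fourier sum over k
isolates g_{n,m}(-1/τ) (`multiplier_mul_sum_F`).

Finally z tends to 0. The theta functions beside g_{n,m}(-1/τ) assemble by Poisson summation into a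
multiple of Σ q^{m j²}, an eta quotient by the triple product. On the other side the residues for n'
= 0 cancel in the sum over ν', and geometric expansion identifies the regularized values of h with
the double sums D (`D_eq_hReg`). -/

/-- The exponential `e ^ (2 π i x)`. -/
noncomputable def qe (x : ℂ) : ℂ := cexp (2 * (Real.pi : ℂ) * I * x)

lemma qe_add (x y : ℂ) : qe (x + y) = qe x * qe y := by
  simp only [qe, ← Complex.exp_add, mul_add]

lemma qe_neg (x : ℂ) : qe (-x) = (qe x)⁻¹ := by
  simp only [qe, ← Complex.exp_neg, mul_neg]

@[simp] lemma qe_zero : qe 0 = 1 := by simp [qe]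

@[simp] lemma qe_ne_zero (x : ℂ) : qe x ≠ 0 := Complex.exp_ne_zero _

@[simp] lemma qe_intCast (n : ℤ) : qe n = 1 := by
  rw [qe, mul_comm, Complex.exp_int_mul_two_pi_mul_I]

lemma qe_add_intCast (x : ℂ) (n : ℤ) : qe (x + n) = qe x := by
  rw [qe_add, qe_intCast, mul_one]

lemma qe_eq_of_sub_eq_intCast {x y : ℂ} (n : ℤ) (h : x - y = n) : qe x = qe y := by
  rw [← qe_add_intCast y n, ← h]; ring_nf

lemma qe_eq_one_iff {x : ℂ} : qe x = 1 ↔ ∃ n : ℤ, x = n := by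
  rw [qe, Complex.exp_eq_one_iff]
  refine exists_congr fun n => ?_
  rw [mul_comm]
  exact mul_left_inj' Complex.two_pi_I_ne_zero

lemma qe_half : qe (1 / 2) = -1 := by
  rw [qe, show 2 * (Real.pi : ℂ) * I * (1 / 2) = Real.pi * I by ring, Complex.exp_pi_mul_I]

lemma neg_qe (x : ℂ) : -qe x = qe (x + 1 / 2) := by
  rw [qe_add, qe_half, mul_neg_one]

lemma qe_intCast_mul (n : ℤ) (x : ℂ) : qe (n * x) = qe x ^ n := by
  rw [qe, qe, ← Complex.exp_int_mul]; ring_nf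

lemma qe_natCast_mul (n : ℕ) (x : ℂ) : qe (n * x) = qe x ^ n := by
  rw [qe, qe, ← Complex.exp_nat_mul]; ring_nf

lemma neg_one_zpow_eq_qe (j : ℤ) : (-1 : ℂ) ^ j = qe (j / 2) := by
  rw [← qe_half, ← qe_intCast_mul]; ring_nf

lemma neg_one_pow_eq_qe (j : ℕ) : (-1 : ℂ) ^ j = qe (j / 2) := by
  rw [← qe_half, ← qe_natCast_mul]; ring_nf

lemma qPow_eq_qe (τ : ℂ) (x : ℝ) : qPow τ x = qe (τ * x) := by
  rw [qPow, qe]; ring_nf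

lemma norm_qe (x : ℂ) : ‖qe x‖ = Real.exp (-(2 * Real.pi * x.im)) := by
  rw [qe, Complex.norm_exp]; simp

lemma norm_qPow (τ : ℂ) (x : ℝ) : ‖qPow τ x‖ = Real.exp (-(2 * Real.pi * τ.im * x)) := by
  rw [qPow_eq_qe, norm_qe]; simp [mul_assoc]

lemma differentiable_qe : Differentiable ℂ qe := by
  unfold qe; fun_prop

@[fun_prop]
lemma continuous_qe : Continuous qe := differentiable_qe.continuous

lemma hasDerivAt_qe (x : ℂ) : HasDerivAt qe (2 * Real.pi * I * qe x) x := by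
  have := ((hasDerivAt_id x).const_mul (2 * (Real.pi : ℂ) * I)).cexp
  rw [mul_one, mul_comm (cexp _)] at this
  exact this

lemma jacobiTheta₂_term_eq_qe (n : ℤ) (z τ : ℂ) :
    jacobiTheta₂_term n z τ = qe (n * z + n ^ 2 * τ / 2) := by
  rw [jacobiTheta₂_term, qe]; ring_nf

lemma jacobiTheta₂_eq_tsum_qe (z τ : ℂ) :
    jacobiTheta₂ z τ = ∑' n : ℤ, qe (n * z + n ^ 2 * τ / 2) := by
  simp only [jacobiTheta₂, jacobiTheta₂_term_eq_qe]

lemma summable_qe_quadratic {a : ℂ} (ha : 0 < a.im) (b c : ℂ) :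
    Summable fun j : ℤ => qe (a * j ^ 2 + b * j + c) := by
  have h := ((summable_jacobiTheta₂_term_iff b (2 * a)).2 (by simpa using ha)).mul_left (qe c)
  refine h.congr fun j => ?_
  rw [jacobiTheta₂_term_eq_qe, ← qe_add]; ring_nf

/-! ### Lattice poles: lower bounds for denominators and holomorphy of sums. -/

/-- The points that are not in the lattice `ℤ + ℤ τ`. -/
def OffLattice (τ v : ℂ) : Prop := ∀ A B : ℤ, v ≠ A + B * τ

lemma OffLattice.add {τ v : ℂ} (h : OffLattice τ v) (A B : ℤ) :
    OffLattice τ (v + A + B * τ) := by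
  intro A' B' e
  refine h (A' - A) (B' - B) ?_
  push_cast
  linear_combination e

lemma OffLattice.qe_ne_one {τ v : ℂ} (h : OffLattice τ v) (J : ℤ) : qe (v + J * τ) ≠ 1 := by
  intro e
  obtain ⟨n, hn⟩ := qe_eq_one_iff.1 e
  refine h n (-J) ?_
  push_cast
  linear_combination hn

lemma OffLattice.one_sub_ne_zero {τ v : ℂ} (h : OffLattice τ v) (J : ℤ) :
    1 - qe (v + J * τ) ≠ 0 := sub_ne_zero.2 (h.qe_ne_one J).symm

/-- The denominators `1 - u q ^ J` are bounded away from zero, locally uniformly. -/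
lemma exists_le_norm_one_sub_qe {τ : ℂ} (hτ : 0 < τ.im) (v₀ : ℂ) (S : Set ℤ)
    (hS : ∀ J ∈ S, qe (v₀ + J * τ) ≠ 1) :
    ∃ δ > 0, ∀ᶠ v in 𝓝 v₀, ∀ J ∈ S, δ ≤ ‖1 - qe (v + J * τ)‖ := by
  -- For |J| > N and v within height 1 of v₀, the point v + Jτ has imaginary part at least 1 in
  -- absolute value. Then |qe| is at least 2 or at most 1/2, so 1/4 bounds all these denominators
  -- and only finitely many J need continuity.
  obtain ⟨N, hN⟩ := exists_nat_gt ((|v₀.im| + 2) / τ.im)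
  have hN' : |v₀.im| + 2 < N * τ.im := (div_lt_iff₀ hτ).1 hN
  have key : ∀ J : ℤ, ∃ δ > 0, δ ≤ (1 / 4 : ℝ) ∧ ∀ᶠ v in 𝓝 v₀, J ∈ S →
      δ ≤ ‖1 - qe (v + J * τ)‖ := by
    intro J
    by_cases hJ : J ∈ S
    · have hpos : 0 < ‖1 - qe (v₀ + J * τ)‖ := norm_pos_iff.2 (sub_ne_zero.2 (hS J hJ).symm)
      refine ⟨min (1 / 4) (‖1 - qe (v₀ + J * τ)‖ / 2), by positivity, min_le_left _ _, ?_⟩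
      have hc : ContinuousAt (fun v => ‖1 - qe (v + J * τ)‖) v₀ := by fun_prop
      filter_upwards [hc.eventually (lt_mem_nhds (half_lt_self hpos))] with v hv _
      exact (min_le_right _ _).trans hv.le
    · exact ⟨1 / 4, by norm_num, le_rfl, Eventually.of_forall fun v h => absurd h hJ⟩
  choose δ hδ hδ4 hev using key
  have hne : (Finset.Icc (-(N : ℤ)) N).Nonempty := ⟨0, by simp⟩
  refine ⟨(Finset.Icc (-(N : ℤ)) N).inf' hne δ, ?_, ?_⟩
  · exact (Finset.lt_inf'_iff hne).2 fun J _ => hδ J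
  · have h1 : ∀ᶠ v in 𝓝 v₀, ∀ J ∈ Finset.Icc (-(N : ℤ)) N, J ∈ S →
        δ J ≤ ‖1 - qe (v + J * τ)‖ := (Finset.eventually_all _).2 fun J _ => hev J
    have h2 : ∀ᶠ v in 𝓝 v₀, |v.im - v₀.im| < 1 := by
      have hc : ContinuousAt (fun v : ℂ => |v.im - v₀.im|) v₀ := by fun_prop
      exact hc.eventually (gt_mem_nhds (by simp))
    filter_upwards [h1, h2] with v hv1 hv2 J hJ
    by_cases hJN : J ∈ Finset.Icc (-(N : ℤ)) N
    · exact (Finset.inf'_le _ hJN).trans (hv1 J hJN hJ)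
    · refine (Finset.inf'_le δ (b := 0) (by simp)).trans ((hδ4 0).trans ?_)
      have him : (v + J * τ).im = v.im + J * τ.im := by simp
      have hb := abs_lt.1 hv2
      have hb0 := abs_le.1 (le_refl |v₀.im|)
      have hpi := Real.pi_gt_three
      rw [Finset.mem_Icc, not_and_or, not_le, not_le] at hJN
      rcases hJN with hJ' | hJ'
      · have hJr : (J : ℝ) ≤ -N := by exact_mod_cast hJ'.le
        have hx : (v + J * τ).im ≤ -1 := by rw [him]; nlinarith
        have : 2 ≤ ‖qe (v + J * τ)‖ := by
          rw [norm_qe]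
          have := Real.add_one_le_exp (-(2 * Real.pi * (v + J * τ).im))
          nlinarith
        have h3 := norm_sub_norm_le (qe (v + J * τ)) 1
        rw [norm_sub_rev] at h3
        simp only [norm_one] at h3
        linarith
      · have hJr : (N : ℝ) ≤ J := by exact_mod_cast hJ'.le
        have hx : 1 ≤ (v + J * τ).im := by rw [him]; nlinarith
        have : ‖qe (v + J * τ)‖ ≤ 1 / 2 := by
          rw [norm_qe, Real.exp_neg]
          have := Real.add_one_le_exp (2 * Real.pi * (v + J * τ).im)
          rw [one_div]
          exact inv_anti₀ (by norm_num) (by nlinarith)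
        have h3 := norm_sub_norm_le 1 (qe (v + J * τ))
        simp only [norm_one] at h3
        linarith

lemma OffLattice.exists_le_norm {τ v : ℂ} (h : OffLattice τ v) (hτ : 0 < τ.im) :
    ∃ δ > 0, ∀ J : ℤ, δ ≤ ‖1 - qe (v + J * τ)‖ := by
  obtain ⟨δ, hδ, hv⟩ := exists_le_norm_one_sub_qe hτ v Set.univ fun J _ => h.qe_ne_one J
  exact ⟨δ, hδ, fun J => hv.self_of_nhds J trivial⟩

lemma summable_div_one_sub {ι : Type*} {a : ι → ℂ} (ha : Summable a) (d : ι → ℂ) {δ : ℝ}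
    (hδ : 0 < δ) (hd : ∀ i, δ ≤ ‖d i‖) : Summable fun i => a i / d i := by
  refine Summable.of_norm_bounded (ha.norm.mul_right δ⁻¹) fun i => ?_
  rw [norm_div, div_eq_mul_inv]
  exact mul_le_mul_of_nonneg_left (inv_anti₀ hδ (hd i)) (norm_nonneg _)

/-- Locally dominated sums of functions with simple poles are differentiable off the poles. -/
lemma differentiableAt_tsum_div_one_sub {τ : ℂ} (hτ : 0 < τ.im) (v₀ : ℂ) (S : Set ℤ)
    (k : ℤ → ℤ) (hS : ∀ j ∈ S, qe (v₀ + k j * τ) ≠ 1) (a : ℤ → ℂ → ℂ)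
    (ha : ∀ j, Differentiable ℂ (a j)) (M : ℤ → ℝ) (hM : Summable M)
    (haM : ∀ᶠ v in 𝓝 v₀, ∀ j, ‖a j v‖ ≤ M j) [DecidablePred (· ∈ S)] :
    DifferentiableAt ℂ
      (fun v => ∑' j, if j ∈ S then a j v / (1 - qe (v + k j * τ)) else 0) v₀ := by
  obtain ⟨δ, hδ, hv⟩ := exists_le_norm_one_sub_qe hτ v₀ (k '' S) (by
    rintro J ⟨j, hj, rfl⟩; exact hS j hj)
  obtain ⟨U, hU, hUo, hU0⟩ := eventually_nhds_iff.1 (hv.and haM)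
  refine DifferentiableOn.differentiableAt (s := U) ?_ (hUo.mem_nhds hU0)
  refine differentiableOn_tsum_of_summable_norm (u := fun j => M j * δ⁻¹) (hM.mul_right _)
    (fun j => ?_) hUo fun j v hvU => ?_
  · by_cases hj : j ∈ S
    · simp only [hj, if_true]
      refine (ha j).differentiableOn.div ?_ fun v hvU h0 => ?_
      · exact ((differentiable_const _).sub
          (differentiable_qe.comp (differentiable_id.add_const _))).differentiableOn
      · have := (hU v hvU).1 (k j) ⟨j, hj, rfl⟩
        rw [h0, norm_zero] at this
        linarith
    · simp only [hj, if_false]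
      exact differentiableOn_const _
  · have hMj := (hU v hvU).2 j
    by_cases hj : j ∈ S
    · simp only [hj, if_true]
      rw [norm_div, div_eq_mul_inv]
      exact mul_le_mul hMj (inv_anti₀ hδ ((hU v hvU).1 (k j) ⟨j, hj, rfl⟩)) (by positivity)
        ((norm_nonneg _).trans hMj)
    · simp only [hj, if_false, norm_zero]
      exact mul_nonneg ((norm_nonneg _).trans hMj) (by positivity)

lemma offLattice_iff {τ v : ℂ} : OffLattice τ v ↔ ∀ J : ℤ, qe (v + J * τ) ≠ 1 := by
  refine ⟨fun h J => h.qe_ne_one J, fun h A B e => h (-B) (qe_eq_one_iff.2 ⟨A, ?_⟩)⟩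
  rw [e]; push_cast; ring

lemma OffLattice.eventually {τ v : ℂ} (h : OffLattice τ v) (hτ : 0 < τ.im) :
    ∀ᶠ w in 𝓝 v, OffLattice τ w := by
  obtain ⟨δ, hδ, hv⟩ := exists_le_norm_one_sub_qe hτ v Set.univ fun J _ => h.qe_ne_one J
  filter_upwards [hv] with w hw
  refine offLattice_iff.2 fun J e => ?_
  have := hw J trivial
  rw [e, sub_self, norm_zero] at this
  linarith

lemma int_mul_qe_ne_one {τ : ℂ} (hτ : 0 < τ.im) {J : ℤ} (hJ : J ≠ 0) : qe (0 + J * τ) ≠ 1 := by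
  intro e
  obtain ⟨n, hn⟩ := qe_eq_one_iff.1 e
  have := congrArg Complex.im hn
  simp [hJ, hτ.ne'] at this

lemma eventually_offLattice {τ : ℂ} (hτ : 0 < τ.im) : ∀ᶠ v in 𝓝[≠] (0 : ℂ), OffLattice τ v := by
  obtain ⟨δ, hδ, hv⟩ := exists_le_norm_one_sub_qe hτ 0 {0}ᶜ fun J hJ => int_mul_qe_ne_one hτ hJ
  have h1 : ∀ᶠ v in 𝓝 (0 : ℂ), ‖v‖ < 1 := by
    have hc : ContinuousAt (fun v : ℂ => ‖v‖) 0 := by fun_prop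
    exact hc.eventually (gt_mem_nhds (by simp))
  filter_upwards [nhdsWithin_le_nhds hv, nhdsWithin_le_nhds h1, self_mem_nhdsWithin]
    with v hv1 hv2 hv3
  refine offLattice_iff.2 fun J e => ?_
  rcases eq_or_ne J 0 with rfl | hJ
  · obtain ⟨n, hn⟩ := qe_eq_one_iff.1 e
    simp only [Int.cast_zero, zero_mul, add_zero] at hn
    rw [hn, Complex.norm_intCast] at hv2
    have hn0 : n = 0 := Int.abs_lt_one_iff.1 (by exact_mod_cast hv2)
    exact hv3 (by simp [hn, hn0])
  · have := hv1 J hJ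
    rw [e, sub_self, norm_zero] at this
    linarith

/-! ### The odd theta function. -/

/-- The odd Jacobi theta function
`∑_N (-1) ^ N e ^ (π i (N + 1 / 2) ^ 2 τ + 2 π i (N + 1 / 2) v)`. -/
noncomputable def oddTheta (τ v : ℂ) : ℂ :=
  qe (τ / 8 + v / 2) * jacobiTheta₂ (v + 1 / 2 + τ / 2) τ

lemma oddTheta_eq_tsum (τ v : ℂ) :
    oddTheta τ v =
      ∑' N : ℤ, qe ((N + 1 / 2) ^ 2 * τ / 2 + (N + 1 / 2) * v + N / 2) := by
  rw [oddTheta, jacobiTheta₂_eq_tsum_qe, ← tsum_mul_left]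
  refine tsum_congr fun N => ?_
  rw [← qe_add]; ring_nf

lemma differentiable_oddTheta {τ : ℂ} (hτ : 0 < τ.im) : Differentiable ℂ (oddTheta τ) := by
  intro v
  unfold oddTheta
  refine DifferentiableAt.mul ?_ ?_
  · exact differentiable_qe.differentiableAt.comp v (by fun_prop)
  · exact DifferentiableAt.comp (g := (jacobiTheta₂ · τ)) v
      (differentiableAt_jacobiTheta₂_fst _ hτ) (by fun_prop)

lemma oddTheta_add_one (τ v : ℂ) : oddTheta τ (v + 1) = -oddTheta τ v := by
  rw [oddTheta, oddTheta, show v + 1 + 1 / 2 + τ / 2 = v + 1 / 2 + τ / 2 + 1 by ring,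
    jacobiTheta₂_add_left, show τ / 8 + (v + 1) / 2 = τ / 8 + v / 2 + 1 / 2 by ring,
    qe_add _ (1 / 2), qe_half]
  ring

lemma oddTheta_add_tau (τ v : ℂ) :
    oddTheta τ (v + τ) = -(qe (-v - τ / 2) * oddTheta τ v) := by
  rw [oddTheta, oddTheta, show v + τ + 1 / 2 + τ / 2 = v + 1 / 2 + τ / 2 + τ by ring,
    jacobiTheta₂_add_left',
    show cexp (-Real.pi * I * (τ + 2 * (v + 1 / 2 + τ / 2))) = qe (-v - τ - 1 / 2) by
      rw [qe]; ring_nf]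
  rw [← mul_assoc, ← mul_assoc, ← qe_add, ← qe_add, ← neg_mul, neg_qe]
  congr 1
  refine qe_eq_of_sub_eq_intCast (-1) ?_
  push_cast; ring

/-- The point 1/2 + τ/2 is its own negative modulo the lattice, and evenness combined with
quasi-periodicity gives the multiplier -1 there. -/
lemma oddTheta_zero (τ : ℂ) : oddTheta τ 0 = 0 := by
  have h : jacobiTheta₂ (1 / 2 + τ / 2) τ = -jacobiTheta₂ (1 / 2 + τ / 2) τ := by
    conv_lhs => rw [show (1 / 2 + τ / 2 : ℂ) = -(1 / 2 + τ / 2) + τ + 1 by ring,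
      jacobiTheta₂_add_left, jacobiTheta₂_add_left', jacobiTheta₂_neg_left,
      show cexp (-Real.pi * I * (τ + 2 * -(1 / 2 + τ / 2))) = qe (1 / 2) by rw [qe]; ring_nf,
      qe_half]
    ring
  rw [oddTheta, zero_add, self_eq_neg.1 h, mul_zero]

/-! ### Appell sums and the reciprocal of the odd theta function. -/

/-- The series `∑_k (-1) ^ k q ^ (k (k - 1) / 2 - M k) / (1 - u q ^ k)` at `u = e ^ (2 π i v)`. -/
noncomputable def appell (τ : ℂ) (M : ℤ) (v : ℂ) : ℂ :=
  ∑' k : ℤ, qe (k / 2 + (k * (k - 1) / 2 - M * k) * τ) / (1 - qe (v + k * τ))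

/-- The reflection k ↦ 2M + 1 - k preserves the exponent of q and changes the parity of k. -/
lemma tsum_qe_alternating (τ : ℂ) (M : ℤ) :
    ∑' k : ℤ, qe (k / 2 + (k * (k - 1) / 2 - M * k) * τ) = 0 := by
  refine self_eq_neg.1 ?_
  conv_lhs => rw [← (Equiv.subLeft (2 * M + 1)).tsum_eq]
  rw [← tsum_neg]
  refine tsum_congr fun k => ?_
  rw [neg_qe, Equiv.subLeft_apply]
  refine qe_eq_of_sub_eq_intCast (M - k) ?_
  push_cast; ring

lemma summable_appell_num {τ : ℂ} (hτ : 0 < τ.im) (M : ℤ) :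
    Summable fun k : ℤ => qe (k / 2 + (k * (k - 1) / 2 - M * k) * τ) := by
  refine (summable_qe_quadratic (a := τ / 2) (by simpa using hτ)
    (1 / 2 - (1 / 2 + M) * τ) 0).congr fun k => ?_
  ring_nf

lemma summable_appell {τ : ℂ} (hτ : 0 < τ.im) {v : ℂ} (hv : OffLattice τ v) (M : ℤ) :
    Summable fun k : ℤ =>
      qe (k / 2 + (k * (k - 1) / 2 - M * k) * τ) / (1 - qe (v + k * τ)) := by
  obtain ⟨δ, hδ, h⟩ := hv.exists_le_norm hτ
  exact summable_div_one_sub (summable_appell_num hτ M) _ hδ h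

/-- In the difference of the two sides each numerator acquires the factor 1 - u q^k, which cancels
the denominator and leaves the vanishing alternating series. -/
lemma appell_succ {τ : ℂ} (hτ : 0 < τ.im) {v : ℂ} (hv : OffLattice τ v) (M : ℤ) :
    appell τ (M + 1) v = qe v * appell τ M v := by
  rw [← sub_eq_zero, appell, appell, ← tsum_mul_left,
    ← (summable_appell hτ hv _).tsum_sub ((summable_appell hτ hv _).mul_left _),
    ← tsum_qe_alternating τ (M + 1)]
  refine tsum_congr fun k => ?_
  have h0 := hv.one_sub_ne_zero k
  rw [← mul_div_assoc, ← sub_div, div_eq_iff h0, mul_sub (qe _), mul_one (qe _), ← qe_add, ← qe_add]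
  push_cast
  ring_nf

lemma appell_eq {τ : ℂ} (hτ : 0 < τ.im) {v : ℂ} (hv : OffLattice τ v) (M : ℤ) :
    appell τ M v = qe ((M + 1) * v) * appell τ (-1) v := by
  induction M using Int.inductionOn' (b := -1) with
  | zero => simp
  | succ k _ ih =>
    rw [appell_succ hτ hv, ih, ← mul_assoc, ← qe_add]; push_cast; ring_nf
  | pred k _ ih =>
    have h := appell_succ hτ hv (k - 1)
    rw [sub_add_cancel, ih] at h
    refine mul_left_cancel₀ (qe_ne_zero v) ?_
    rw [← h, ← mul_assoc, ← qe_add]; push_cast; ring_nf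

/-- The series `∑_k (-1) ^ k q ^ (k (k + 1) / 2) u ^ (1 / 2) / (1 - u q ^ k)`, a constant multiple
of the reciprocal of the odd theta function. -/
noncomputable def thetaRecip (τ v : ℂ) : ℂ := qe (v / 2) * appell τ (-1) v

lemma thetaRecip_add_one (τ v : ℂ) : thetaRecip τ (v + 1) = -thetaRecip τ v := by
  have h : appell τ (-1) (v + 1) = appell τ (-1) v := by
    refine tsum_congr fun k => ?_
    rw [qe_eq_of_sub_eq_intCast (x := v + 1 + k * τ) (y := v + k * τ) 1 (by push_cast; ring)]
  rw [thetaRecip, thetaRecip, h, add_div, qe_add, qe_half]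
  ring

/-- Shifting k by one absorbs τ into the denominators and raises the parameter from -1 to 0;
`appell_succ` brings it back. The multiplier is inverse to that of `oddTheta`. -/
lemma thetaRecip_add_tau {τ : ℂ} (hτ : 0 < τ.im) {v : ℂ} (hv : OffLattice τ v) :
    thetaRecip τ (v + τ) = -(qe (v + τ / 2) * thetaRecip τ v) := by
  have h : appell τ (-1) (v + τ) = -(qe v * appell τ (-1) v) := by
    rw [← appell_succ hτ hv, appell, appell, ← (Equiv.subRight (1 : ℤ)).tsum_eq, ← tsum_neg]
    refine tsum_congr fun k => ?_
    rw [Equiv.subRight_apply, ← neg_div, neg_qe]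
    congr 1
    · refine qe_eq_of_sub_eq_intCast (-1) ?_
      push_cast; ring
    · push_cast; ring_nf
  rw [thetaRecip, thetaRecip, h, mul_neg, ← mul_assoc, ← mul_assoc, ← qe_add, ← qe_add]
  ring_nf

/-- The value of the constant `thetaRecip τ v * oddTheta τ v`. -/
noncomputable def thetaConst (τ : ℂ) : ℂ := -deriv (oddTheta τ) 0 / (2 * Real.pi * I)

open Classical in
/-- The product `thetaRecip τ v * oddTheta τ v` with its removable singularities removed. -/
noncomputable def thetaProd (τ v : ℂ) : ℂ :=
  if OffLattice τ v then thetaRecip τ v * oddTheta τ v else thetaConst τ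

lemma offLattice_add_one_iff {τ v : ℂ} : OffLattice τ (v + 1) ↔ OffLattice τ v := by
  constructor <;> intro h
  · convert h.add (-1) 0 using 1; push_cast; ring
  · convert h.add 1 0 using 1; push_cast; ring

lemma offLattice_add_tau_iff {τ v : ℂ} : OffLattice τ (v + τ) ↔ OffLattice τ v := by
  constructor <;> intro h
  · convert h.add 0 (-1) using 1; push_cast; ring
  · convert h.add 0 1 using 1; push_cast; ring

lemma thetaProd_add_one (τ : ℂ) : Function.Periodic (thetaProd τ) 1 := by
  intro v
  by_cases hv : OffLattice τ v
  · rw [thetaProd, thetaProd, if_pos hv, if_pos (offLattice_add_one_iff.2 hv),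
      thetaRecip_add_one, oddTheta_add_one, neg_mul_neg]
  · rw [thetaProd, thetaProd, if_neg hv, if_neg (offLattice_add_one_iff.not.2 hv)]

lemma thetaProd_add_tau {τ : ℂ} (hτ : 0 < τ.im) : Function.Periodic (thetaProd τ) τ := by
  intro v
  by_cases hv : OffLattice τ v
  · rw [thetaProd, thetaProd, if_pos hv, if_pos (offLattice_add_tau_iff.2 hv),
      thetaRecip_add_tau hτ hv, oddTheta_add_tau, neg_mul_neg, mul_mul_mul_comm, ← qe_add]
    ring_nf
    simp
  · rw [thetaProd, thetaProd, if_neg hv, if_neg (offLattice_add_tau_iff.not.2 hv)]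

lemma thetaProd_add_lattice {τ : ℂ} (hτ : 0 < τ.im) (v : ℂ) (A B : ℤ) :
    thetaProd τ (v + A + B * τ) = thetaProd τ v := by
  rw [(thetaProd_add_tau hτ).int_mul B]
  simpa using (thetaProd_add_one τ).int_mul A v

lemma differentiableAt_thetaRecip {τ : ℂ} (hτ : 0 < τ.im) {v : ℂ} (hv : OffLattice τ v) :
    DifferentiableAt ℂ (thetaRecip τ) v := by
  classical
  have h := differentiableAt_tsum_div_one_sub hτ v Set.univ id (fun j _ => hv.qe_ne_one j)
    (fun k _ => qe (k / 2 + (k * (k - 1) / 2 - (-1 : ℤ) * k) * τ)) (fun _ => by fun_prop) _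
    (summable_appell_num hτ (-1)).norm (Eventually.of_forall fun _ _ => le_rfl)
  simp only [Set.mem_univ, if_true, id] at h
  exact (differentiable_qe.differentiableAt.comp v (by fun_prop)).mul h

/-- Only the term k = 0 has a pole at 0. It is simple and meets a zero of `oddTheta`, so dividing
both functions by v (`dslope`) gives a holomorphic expression whose value at 0 is the ratio of
derivatives, `thetaConst`. -/
lemma differentiableAt_thetaProd_zero {τ : ℂ} (hτ : 0 < τ.im) :
    DifferentiableAt ℂ (thetaProd τ) 0 := by
  classical
  set r : ℂ → ℂ := fun v => ∑' j : ℤ, if j ∈ ({0}ᶜ : Set ℤ) then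
    qe (j / 2 + (j * (j - 1) / 2 - (-1 : ℤ) * j) * τ) / (1 - qe (v + (id j : ℤ) * τ)) else 0
    with hr
  have hrd : DifferentiableAt ℂ r 0 :=
    differentiableAt_tsum_div_one_sub hτ 0 {0}ᶜ id (fun j hj => int_mul_qe_ne_one hτ hj)
      (fun k _ => qe (k / 2 + (k * (k - 1) / 2 - (-1 : ℤ) * k) * τ)) (fun _ => by fun_prop) _
      (summable_appell_num hτ (-1)).norm (Eventually.of_forall fun _ _ => le_rfl)
  have hslope : ∀ f : ℂ → ℂ, Differentiable ℂ f → DifferentiableAt ℂ (dslope f 0) 0 := by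
    intro f hf
    exact ((Complex.differentiableOn_dslope (s := Set.univ) univ_mem).2
      hf.differentiableOn).differentiableAt univ_mem
  have hk : Differentiable ℂ fun v => 1 - qe v := (differentiable_const _).sub differentiable_qe
  have hk0 : dslope (fun v => 1 - qe v) 0 0 = -(2 * Real.pi * I) := by
    rw [dslope_same]
    simpa using ((hasDerivAt_qe 0).const_sub 1).deriv
  have hpi : (2 * Real.pi * I : ℂ) ≠ 0 := Complex.two_pi_I_ne_zero
  have hg : DifferentiableAt ℂ (fun v => qe (v / 2) *
      (dslope (oddTheta τ) 0 v / dslope (fun v => 1 - qe v) 0 v + oddTheta τ v * r v)) 0 := by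
    refine (differentiable_qe.differentiableAt.comp 0 (by fun_prop)).mul
      (((hslope _ (differentiable_oddTheta hτ)).div (hslope _ hk) ?_).add
        ((differentiable_oddTheta hτ 0).mul hrd))
    rw [hk0]; exact neg_ne_zero.2 hpi
  refine hg.congr_of_eventuallyEq ?_
  have hev := eventually_nhdsWithin_iff.1 (eventually_offLattice hτ)
  filter_upwards [hev] with v hv
  rcases eq_or_ne v 0 with rfl | hv0
  · have h0 : ¬ OffLattice τ 0 := fun h => h 0 0 (by simp)
    rw [thetaProd, if_neg h0, hk0, oddTheta_zero, dslope_same, thetaConst, zero_div, qe_zero]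
    rw [neg_div, div_neg]; ring
  · have hoff := hv hv0
    rw [thetaProd, if_pos hoff, dslope_of_ne _ hv0, dslope_of_ne _ hv0, slope_def_field,
      slope_def_field, oddTheta_zero, qe_zero, sub_self, sub_zero, sub_zero, sub_zero,
      div_div_div_cancel_right₀ hv0]
    have hB : appell τ (-1) v = 1 / (1 - qe v) + r v := by
      rw [appell, (summable_appell hτ hoff (-1)).tsum_eq_add_tsum_ite 0]
      simp only [hr, Set.mem_compl_iff, Set.mem_singleton_iff, ite_not, id]
      simp
    rw [thetaRecip, hB]
    ring

lemma differentiable_thetaProd {τ : ℂ} (hτ : 0 < τ.im) : Differentiable ℂ (thetaProd τ) := by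
  intro v
  by_cases hv : OffLattice τ v
  · have h := (differentiableAt_thetaRecip hτ hv).mul (differentiable_oddTheta hτ v)
    refine h.congr_of_eventuallyEq ?_
    filter_upwards [hv.eventually hτ] with w hw
    rw [thetaProd, if_pos hw]; rfl
  · obtain ⟨A, B, rfl⟩ : ∃ A B : ℤ, v = A + B * τ := by
      by_contra! h; exact hv h
    have h : thetaProd τ = fun w => thetaProd τ (w - (A + B * τ)) := by
      funext w
      rw [← thetaProd_add_lattice hτ (w - (A + B * τ)) A B]
      ring_nf
    rw [h]
    refine DifferentiableAt.comp (g := thetaProd τ) (A + B * τ : ℂ) ?_ (by fun_prop)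
    rw [sub_self]
    exact differentiableAt_thetaProd_zero hτ

lemma isBounded_range_thetaProd {τ : ℂ} (hτ : 0 < τ.im) :
    Bornology.IsBounded (Set.range (thetaProd τ)) := by
  have hcpt : IsCompact ((fun p : ℝ × ℝ => thetaProd τ (p.1 + p.2 * τ)) ''
      (Set.Icc 0 1 ×ˢ Set.Icc 0 1)) := by
    refine (isCompact_Icc.prod isCompact_Icc).image ?_
    exact (differentiable_thetaProd hτ).continuous.comp (by fun_prop)
  refine hcpt.isBounded.subset ?_
  rintro _ ⟨v, rfl⟩
  set t := v.im / τ.im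
  set s := v.re - t * τ.re
  have hv : v = s + t * τ := by
    apply Complex.ext
    · simp [s]
    · simp [t, hτ.ne']
  refine ⟨(Int.fract s, Int.fract t), ⟨⟨Int.fract_nonneg _, (Int.fract_lt_one _).le⟩,
    ⟨Int.fract_nonneg _, (Int.fract_lt_one _).le⟩⟩, ?_⟩
  have hs : (s : ℂ) = ⌊s⌋ + Int.fract s := by exact_mod_cast (Int.floor_add_fract s).symm
  have ht : (t : ℂ) = ⌊t⌋ + Int.fract t := by exact_mod_cast (Int.floor_add_fract t).symm
  dsimp only
  rw [← thetaProd_add_lattice hτ (Int.fract s + Int.fract t * τ) ⌊s⌋ ⌊t⌋]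
  congr 1
  linear_combination -hv - hs - τ * ht

/-- Liouville's theorem: the completed product is entire and doubly periodic, hence bounded, hence
equal to its value at 0. -/
theorem thetaRecip_mul_oddTheta {τ : ℂ} (hτ : 0 < τ.im) {v : ℂ} (hv : OffLattice τ v) :
    thetaRecip τ v * oddTheta τ v = thetaConst τ := by
  have h := (differentiable_thetaProd hτ).apply_eq_apply_of_bounded
    (isBounded_range_thetaProd hτ) v 0
  have h0 : ¬ OffLattice τ 0 := fun h => h 0 0 (by simp)
  rwa [thetaProd, thetaProd, if_pos hv, if_neg h0] at h

/-! ### The Jacobi triple product, from its finite form. -/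

lemma norm_qe_lt_one {τ : ℂ} (hτ : 0 < τ.im) : ‖qe τ‖ < 1 := by
  rw [norm_qe, Real.exp_lt_one_iff]
  have := Real.pi_pos
  have : 0 < 2 * Real.pi * τ.im := by positivity
  linarith

lemma qe_succ_mul_ne_one {τ : ℂ} (hτ : 0 < τ.im) (i : ℕ) : 1 - qe ((i + 1) * τ) ≠ 0 := by
  have := int_mul_qe_ne_one hτ (J := i + 1) (by positivity)
  rw [zero_add] at this
  push_cast at this
  exact sub_ne_zero.2 this.symm

lemma summable_norm_qe_linear {τ : ℂ} (hτ : 0 < τ.im) (z : ℂ) :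
    Summable fun i : ℕ => ‖qe (z + i * τ)‖ := by
  simp only [qe_add, qe_natCast_mul, norm_mul, norm_pow]
  exact (summable_geometric_of_lt_one (norm_nonneg _) (norm_qe_lt_one hτ)).mul_left _

lemma multipliable_one_add_qe {τ : ℂ} (hτ : 0 < τ.im) (z : ℂ) :
    Multipliable fun i : ℕ => 1 + qe (z + i * τ) :=
  multipliable_one_add_of_summable (summable_norm_qe_linear hτ z)

lemma multipliable_qPochhammer {τ : ℂ} (hτ : 0 < τ.im) :
    Multipliable fun i : ℕ => 1 - qe ((i + 1) * τ) := by
  refine (multipliable_one_add_qe hτ (τ + 1 / 2)).congr fun i => ?_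
  rw [sub_eq_add_neg, neg_qe]; ring_nf

lemma tprod_qPochhammer_ne_zero {τ : ℂ} (hτ : 0 < τ.im) :
    ∏' i : ℕ, (1 - qe ((i + 1) * τ)) ≠ 0 := by
  have h : ∀ i : ℕ, 1 - qe ((i + 1) * τ) = 1 + qe (τ + 1 / 2 + i * τ) := fun i => by
    rw [sub_eq_add_neg, neg_qe]; ring_nf
  simp only [h]
  exact tprod_one_add_ne_zero_of_summable (fun i => h i ▸ qe_succ_mul_ne_one hτ i)
    (summable_norm_qe_linear hτ _)

/-- The finite product `(1 - q) ⋯ (1 - q ^ n)`. -/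
noncomputable def qPochhammer (τ : ℂ) (n : ℕ) : ℂ := ∏ i ∈ Finset.range n, (1 - qe ((i + 1) * τ))

/-- The reciprocal of `qPochhammer`, extended by zero to the negative integers. -/
noncomputable def qPochhammerInv (τ : ℂ) (n : ℤ) : ℂ :=
  if 0 ≤ n then (qPochhammer τ n.toNat)⁻¹ else 0

lemma qPochhammer_succ (τ : ℂ) (n : ℕ) :
    qPochhammer τ (n + 1) = qPochhammer τ n * (1 - qe ((n + 1) * τ)) :=
  Finset.prod_range_succ _ _

/-- The extension by zero is consistent at n = 0 because the factor 1 - q^0 vanishes; thus no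
boundary cases arise in the recurrence for the finite product. -/
lemma qPochhammerInv_sub_one {τ : ℂ} (hτ : 0 < τ.im) (n : ℤ) :
    qPochhammerInv τ (n - 1) = (1 - qe (n * τ)) * qPochhammerInv τ n := by
  rcases lt_trichotomy n 0 with hn | rfl | hn
  · rw [qPochhammerInv, qPochhammerInv, if_neg (by omega), if_neg (by omega), mul_zero]
  · rw [qPochhammerInv, if_neg (by omega)]; simp
  · obtain ⟨k, rfl⟩ : ∃ k : ℕ, n = k + 1 := ⟨(n - 1).toNat, by omega⟩
    rw [qPochhammerInv, qPochhammerInv, if_pos (by omega), if_pos (by omega), add_sub_cancel_right,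
      Int.toNat_natCast, show ((k : ℤ) + 1).toNat = k + 1 by omega, qPochhammer_succ, mul_inv]
    have := qe_succ_mul_ne_one hτ k
    push_cast
    field_simp

/-- The terms of the finite form of the Jacobi triple product. -/
noncomputable def finiteThetaTerm (τ z : ℂ) (N : ℕ) (k : ℤ) : ℂ :=
  qe (k * z + k ^ 2 * τ / 2) * qPochhammer τ (2 * N) *
    (qPochhammerInv τ (N + k) * qPochhammerInv τ (N - k))

/-- The three coefficients come from expanding the next factor (1 + u q^{N+1/2})(1 + u⁻¹ q^{N+1/2}).
With q, q^{N+k} and q^{N-k} as independent variables and the common Pochhammer factors removed, it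
is a polynomial identity. -/
lemma finiteThetaTerm_succ {τ : ℂ} (hτ : 0 < τ.im) (z : ℂ) (N : ℕ) (k : ℤ) :
    finiteThetaTerm τ z (N + 1) k = (1 + qe ((2 * N + 1) * τ)) * finiteThetaTerm τ z N k +
      qe (z + (N + 1 / 2) * τ) * finiteThetaTerm τ z N (k - 1) +
      qe (-z + (N + 1 / 2) * τ) * finiteThetaTerm τ z N (k + 1) := by
  simp only [finiteThetaTerm]
  have hA1 : qPochhammerInv τ (N + k) =
      (1 - qe τ * qe ((N + k) * τ)) * qPochhammerInv τ (↑(N + 1) + k) := by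
    have := qPochhammerInv_sub_one hτ (N + 1 + k)
    rw [show (N + 1 + k - 1 : ℤ) = N + k by ring] at this
    rw [this, ← qe_add]; push_cast; ring_nf
  have hA2 : qPochhammerInv τ (N + (k - 1)) =
      (1 - qe ((N + k) * τ)) * ((1 - qe τ * qe ((N + k) * τ)) *
        qPochhammerInv τ (↑(N + 1) + k)) := by
    rw [← hA1, show (N + (k - 1) : ℤ) = N + k - 1 by ring, qPochhammerInv_sub_one hτ]; push_cast; rfl
  have hB1 : qPochhammerInv τ (N - k) =
      (1 - qe τ * qe ((N - k) * τ)) * qPochhammerInv τ (↑(N + 1) - k) := by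
    have := qPochhammerInv_sub_one hτ (N + 1 - k)
    rw [show (N + 1 - k - 1 : ℤ) = N - k by ring] at this
    rw [this, ← qe_add]; push_cast; ring_nf
  have hB2 : qPochhammerInv τ (N - (k + 1)) =
      (1 - qe ((N - k) * τ)) * ((1 - qe τ * qe ((N - k) * τ)) *
        qPochhammerInv τ (↑(N + 1) - k)) := by
    rw [← hB1, show (N - (k + 1) : ℤ) = N - k - 1 by ring, qPochhammerInv_sub_one hτ]; push_cast; rfl
  have hA3 : qPochhammerInv τ (N + (k + 1)) = qPochhammerInv τ (↑(N + 1) + k) := by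
    congr 1; push_cast; ring
  have hB3 : qPochhammerInv τ (N - (k - 1)) = qPochhammerInv τ (↑(N + 1) - k) := by
    congr 1; push_cast; ring
  have hP : qPochhammer τ (2 * (N + 1)) = qPochhammer τ (2 * N) *
      (1 - qe τ * qe ((N + k) * τ) * qe ((N - k) * τ)) *
      (1 - qe τ * qe τ * qe ((N + k) * τ) * qe ((N - k) * τ)) := by
    rw [show 2 * (N + 1) = 2 * N + 1 + 1 by ring, qPochhammer_succ, qPochhammer_succ]
    simp only [← qe_add]
    push_cast
    ring_nf
  have h1 : qe ((2 * N + 1) * τ) = qe τ * qe ((N + k) * τ) * qe ((N - k) * τ) := by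
    simp only [← qe_add]; ring_nf
  have h2 : qe (z + (N + 1 / 2) * τ) * qe (↑(k - 1) * z + (↑(k - 1) : ℂ) ^ 2 * τ / 2) =
      qe (k * z + k ^ 2 * τ / 2) * (qe τ * qe ((N - k) * τ)) := by
    simp only [← qe_add]; push_cast; ring_nf
  have h3 : qe (-z + (N + 1 / 2) * τ) * qe (↑(k + 1) * z + (↑(k + 1) : ℂ) ^ 2 * τ / 2) =
      qe (k * z + k ^ 2 * τ / 2) * (qe τ * qe ((N + k) * τ)) := by
    simp only [← qe_add]; push_cast; ring_nf
  rw [← mul_assoc (qe (z + _)), ← mul_assoc (qe (z + _)), h2, ← mul_assoc (qe (-z + _)),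
    ← mul_assoc (qe (-z + _)), h3, hA3, hB3, hA2, hB2, hA1, hB1, hP, h1]
  ring

lemma hasSum_finiteThetaTerm {τ : ℂ} (hτ : 0 < τ.im) (z : ℂ) (N : ℕ) :
    HasSum (finiteThetaTerm τ z N)
      (∏ i ∈ Finset.range N, (1 + qe (z + (i + 1 / 2) * τ)) * (1 + qe (-z + (i + 1 / 2) * τ))) := by
  induction N with
  | zero =>
    convert hasSum_single (f := finiteThetaTerm τ z 0) (0 : ℤ) fun k hk => ?_ using 1
    · simp [finiteThetaTerm, qPochhammer, qPochhammerInv]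
    · rcases lt_or_gt_of_ne hk with h | h
      · simp [finiteThetaTerm, qPochhammerInv, not_le.2 h]
      · simp [finiteThetaTerm, qPochhammerInv, not_le.2 h]
  | succ N ih =>
    have h1 := (Equiv.subRight (1 : ℤ)).hasSum_iff.2 ih
    have h2 := (Equiv.addRight (1 : ℤ)).hasSum_iff.2 ih
    have h3 := ((ih.mul_left (1 + qe ((2 * N + 1) * τ))).add
      (h1.mul_left (qe (z + (N + 1 / 2) * τ)))).add (h2.mul_left (qe (-z + (N + 1 / 2) * τ)))
    have h4 : qe ((2 * N + 1) * τ) = qe (z + (N + 1 / 2) * τ) * qe (-z + (N + 1 / 2) * τ) := by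
      rw [← qe_add]; ring_nf
    rw [Finset.prod_range_succ, funext fun k => finiteThetaTerm_succ hτ z N k]
    refine Eq.subst (motive := fun s => HasSum _ s) ?_ h3
    rw [h4]
    ring


lemma tendsto_qPochhammer {τ : ℂ} (hτ : 0 < τ.im) :
    Tendsto (qPochhammer τ) atTop (𝓝 (∏' i : ℕ, (1 - qe ((i + 1) * τ)))) :=
  (multipliable_qPochhammer hτ).hasProd.tendsto_prod_nat

lemma tendsto_qPochhammerInv {τ : ℂ} (hτ : 0 < τ.im) :
    Tendsto (qPochhammerInv τ) atTop (𝓝 (∏' i : ℕ, (1 - qe ((i + 1) * τ)))⁻¹) := by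
  have hN : Tendsto Int.toNat atTop atTop :=
    tendsto_atTop.2 fun b => (eventually_ge_atTop (b : ℤ)).mono fun a ha => by omega
  have h := ((tendsto_qPochhammer hτ).comp hN).inv₀
    (tprod_qPochhammer_ne_zero hτ)
  refine h.congr' ?_
  filter_upwards [eventually_ge_atTop 0] with n hn
  rw [qPochhammerInv, if_pos hn]; rfl

lemma exists_norm_qPochhammer_le {τ : ℂ} (hτ : 0 < τ.im) :
    ∃ C : ℝ, ∀ n, ‖qPochhammer τ n‖ ≤ C := by
  obtain ⟨C, hC⟩ := isBounded_iff_forall_norm_le.1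
    (Metric.isBounded_range_of_tendsto _ (tendsto_qPochhammer hτ))
  exact ⟨C, fun n => hC _ ⟨n, rfl⟩⟩

lemma exists_norm_qPochhammerInv_le {τ : ℂ} (hτ : 0 < τ.im) :
    ∃ C : ℝ, ∀ n, ‖qPochhammerInv τ n‖ ≤ C := by
  obtain ⟨C, hC⟩ := isBounded_iff_forall_norm_le.1 (Metric.isBounded_range_of_tendsto _
    ((tendsto_qPochhammerInv hτ).comp (tendsto_natCast_atTop_atTop (R := ℤ))))
  refine ⟨C, fun n => ?_⟩
  by_cases hn : 0 ≤ n
  · lift n to ℕ using hn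
    exact hC _ ⟨n, rfl⟩
  · rw [qPochhammerInv, if_neg hn, norm_zero]
    exact (norm_nonneg _).trans (hC _ ⟨0, rfl⟩)

/-- The Jacobi triple product identity. -/
theorem jacobiTheta₂_eq_tprod {τ : ℂ} (hτ : 0 < τ.im) (z : ℂ) :
    jacobiTheta₂ z τ = (∏' i : ℕ, (1 - qe ((i + 1) * τ))) *
      ((∏' i : ℕ, (1 + qe (z + τ / 2 + i * τ))) * ∏' i : ℕ, (1 + qe (-z + τ / 2 + i * τ))) := by
  set P := ∏' i : ℕ, (1 - qe ((i + 1) * τ)) with hP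
  have hP0 : P ≠ 0 := tprod_qPochhammer_ne_zero hτ
  obtain ⟨C, hC⟩ := exists_norm_qPochhammer_le hτ
  obtain ⟨C', hC'⟩ := exists_norm_qPochhammerInv_le hτ
  have hsum : Summable fun k : ℤ => ‖qe (k * z + k ^ 2 * τ / 2)‖ * C * (C' * C') := by
    refine ((((summable_qe_quadratic (a := τ / 2) (by simpa using hτ) z 0).congr
      fun k => ?_).norm).mul_right C).mul_right (C' * C')
    ring_nf
  -- Tannery's theorem: the Pochhammer factors are bounded uniformly in N and k, so the Gaussian
  -- factor dominates.
  have hlim : Tendsto (fun N => ∑' k, finiteThetaTerm τ z N k) atTop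
      (𝓝 (∑' k : ℤ, qe (k * z + k ^ 2 * τ / 2) * P * (P⁻¹ * P⁻¹))) := by
    refine tendsto_tsum_of_dominated_convergence hsum (fun k => ?_) (Eventually.of_forall
      fun N k => ?_)
    · have h1 : Tendsto (fun N : ℕ => 2 * N) atTop atTop :=
        tendsto_id.const_mul_atTop' (by norm_num)
      have h2 : Tendsto (fun N : ℕ => (N : ℤ) + k) atTop atTop :=
        tendsto_atTop_add_const_right _ _ tendsto_natCast_atTop_atTop
      have h3 : Tendsto (fun N : ℕ => (N : ℤ) - k) atTop atTop :=
        tendsto_atTop_add_const_right _ _ tendsto_natCast_atTop_atTop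
      exact (((tendsto_qPochhammer hτ).comp h1).const_mul _).mul
        (((tendsto_qPochhammerInv hτ).comp h2).mul ((tendsto_qPochhammerInv hτ).comp h3))
    · rw [finiteThetaTerm, norm_mul, norm_mul, norm_mul]
      have := hC (2 * N)
      have := hC' (N + k)
      have := hC' (N - k)
      have : 0 ≤ C := (norm_nonneg _).trans (hC 0)
      have : 0 ≤ C' := (norm_nonneg _).trans (hC' 0)
      gcongr
  have hlim2 : Tendsto (fun N => ∑' k, finiteThetaTerm τ z N k) atTop
      (𝓝 ((∏' i : ℕ, (1 + qe (z + τ / 2 + i * τ))) * ∏' i : ℕ, (1 + qe (-z + τ / 2 + i * τ)))) := by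
    refine (((multipliable_one_add_qe hτ (z + τ / 2)).hasProd.mul
      (multipliable_one_add_qe hτ (-z + τ / 2)).hasProd).tendsto_prod_nat).congr fun N => ?_
    rw [(hasSum_finiteThetaTerm hτ z N).tsum_eq]
    refine Finset.prod_congr rfl fun i _ => ?_
    ring_nf
  rw [← tendsto_nhds_unique hlim hlim2, tsum_mul_right, tsum_mul_right, jacobiTheta₂_eq_tsum_qe, ← mul_assoc,
    mul_comm P, mul_assoc, mul_assoc, mul_inv_cancel_left₀ hP0, mul_inv_cancel₀ hP0, mul_one]

lemma one_add_qe_ne_zero {x : ℂ} (h : qe (x + 1 / 2) ≠ 1) : 1 + qe x ≠ 0 := by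
  intro e
  refine h ?_
  rw [← neg_qe]
  linear_combination -e

/-- By the triple product, a zero would come from a single factor, and each factor vanishes only at
lattice points. -/
theorem oddTheta_ne_zero {τ : ℂ} (hτ : 0 < τ.im) {v : ℂ} (hv : OffLattice τ v) :
    oddTheta τ v ≠ 0 := by
  have h1 : ∏' i : ℕ, (1 + qe (v + 1 / 2 + τ / 2 + τ / 2 + i * τ)) ≠ 0 := by
    refine tprod_one_add_ne_zero_of_summable (fun i => one_add_qe_ne_zero fun e => ?_)
      (summable_norm_qe_linear hτ _)
    refine hv.qe_ne_one (i + 1) ?_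
    rw [← e]
    refine qe_eq_of_sub_eq_intCast (-1) ?_
    push_cast; ring
  have h2 : ∏' i : ℕ, (1 + qe (-(v + 1 / 2 + τ / 2) + τ / 2 + i * τ)) ≠ 0 := by
    refine tprod_one_add_ne_zero_of_summable (fun i => one_add_qe_ne_zero fun e => ?_)
      (summable_norm_qe_linear hτ _)
    refine hv.qe_ne_one (-i) ?_
    rw [← inv_eq_one, ← qe_neg, ← e]
    refine qe_eq_of_sub_eq_intCast 0 ?_
    push_cast; ring
  rw [oddTheta, jacobiTheta₂_eq_tprod hτ]
  exact mul_ne_zero (qe_ne_zero _) (mul_ne_zero (tprod_qPochhammer_ne_zero hτ) (mul_ne_zero h1 h2))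

/-! ### The theta constant as an eta quotient. -/

lemma tprod_one_sub_pow_eq {x : ℂ} (hx : ‖x‖ < 1) :
    ∏' i : ℕ, (1 - x ^ (i + 1)) =
      (∏' i : ℕ, (1 - x ^ (2 * i + 1))) * ∏' i : ℕ, (1 - (x ^ 2) ^ (i + 1)) := by
  have hs : Summable fun i : ℕ => ‖x‖ ^ i := summable_geometric_of_lt_one (norm_nonneg _) hx
  have hm : ∀ f : ℕ → ℕ, Function.Injective f → Multipliable fun i : ℕ => 1 - x ^ f i := by
    intro f hf
    simp only [sub_eq_add_neg]
    refine multipliable_one_add_of_summable ?_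
    simp only [norm_neg, norm_pow]
    exact hs.comp_injective hf
  have h := tprod_even_mul_odd (f := fun i : ℕ => 1 - x ^ (i + 1))
    (hm (fun k => 2 * k + 1) fun a b h => by simpa using h)
    (hm (fun k => 2 * k + 1 + 1) fun a b h => by simpa using h)
  rw [← h]
  congr 1
  refine tprod_congr fun i => ?_
  rw [← pow_mul]; ring_nf

lemma eta_eq (T : ℂ) : ModularForm.eta T = qe (T / 24) * ∏' i : ℕ, (1 - qe T ^ (i + 1)) := by
  rw [ModularForm.eta]
  congr 1
  · rw [Function.Periodic.qParam, qe]; push_cast; ring_nf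
  · refine tprod_congr fun i => ?_
    rw [ModularForm.eta_q_eq_pow, qe]

/-- The theta constant `∑_j q ^ (j ^ 2)` as an eta quotient. -/
theorem jacobiTheta_eq_eta_quotient {T : ℂ} (hT : 0 < T.im) :
    jacobiTheta (2 * T) = ModularForm.eta (2 * T) ^ 5 /
      (ModularForm.eta T ^ 2 * ModularForm.eta (4 * T) ^ 2) := by
  have h2T : 0 < (2 * T).im := by simpa using hT
  have h4T : 0 < (4 * T).im := by simpa using hT
  have hpow2 : qe (2 * T) = qe T ^ 2 := by
    rw [← qe_natCast_mul]; push_cast; rfl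
  have hpow4 : qe (4 * T) = (qe T ^ 2) ^ 2 := by
    rw [← hpow2, ← qe_natCast_mul]; push_cast; ring_nf
  have hne : ∀ S : ℂ, 0 < S.im → ∏' i : ℕ, (1 - qe S ^ (i + 1)) ≠ 0 := fun S hS => by
    have := tprod_qPochhammer_ne_zero hS
    convert this using 4 with i
    rw [← qe_natCast_mul]; push_cast; rfl
  have hx : ‖qe T‖ < 1 := norm_qe_lt_one hT
  have hx2 : ‖qe T ^ 2‖ < 1 := hpow2 ▸ norm_qe_lt_one h2T
  have hA := tprod_one_sub_pow_eq hx
  have hB := tprod_one_sub_pow_eq hx2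
  have hnA := hne T hT
  have hnB := hne _ h2T
  have hnC := hne _ h4T
  rw [hpow2] at hnB
  rw [hpow4] at hnC
  set A := ∏' i : ℕ, (1 - qe T ^ (i + 1))
  set B := ∏' i : ℕ, (1 - (qe T ^ 2) ^ (i + 1))
  set C := ∏' i : ℕ, (1 - ((qe T ^ 2) ^ 2) ^ (i + 1))
  set O := ∏' i : ℕ, (1 + qe T ^ (2 * i + 1)) with hO
  have hs : Summable fun i : ℕ => ‖qe T ^ (2 * i + 1)‖ := by
    simp only [norm_pow]
    exact (summable_geometric_of_lt_one (norm_nonneg _) hx).comp_injective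
      (i := fun k => 2 * k + 1) fun a b h => by simpa using h
  have hO2 : O * ∏' i : ℕ, (1 - qe T ^ (2 * i + 1)) =
      ∏' i : ℕ, (1 - (qe T ^ 2) ^ (2 * i + 1)) := by
    rw [hO, ← Multipliable.tprod_mul]
    · refine tprod_congr fun i => ?_
      rw [pow_right_comm]; ring
    · exact multipliable_one_add_of_summable hs
    · simp only [sub_eq_add_neg]
      exact multipliable_one_add_of_summable (by simpa only [norm_neg] using hs)
  have hθ : jacobiTheta (2 * T) = B * (O * O) := by
    rw [jacobiTheta_eq_jacobiTheta₂, jacobiTheta₂_eq_tprod h2T]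
    congr 1
    · refine tprod_congr fun i => ?_
      rw [← hpow2, ← qe_natCast_mul]; push_cast; rfl
    · congr 1 <;>
      · refine tprod_congr fun i => ?_
        rw [← qe_natCast_mul]; push_cast; ring_nf
  -- A and B split into odd-index products times B and C. The odd product at q times O is the odd
  -- product at q². Hence the theta constant B O² equals B⁵/(A²C²).
  have key : O * (A * C) = B * B := by
    rw [hA]
    linear_combination B * C * hO2 - B * hB
  have hqe : qe (2 * T / 24) ^ 5 = qe (T / 24) ^ 2 * qe (4 * T / 24) ^ 2 := by
    simp only [← qe_natCast_mul, ← qe_add]; push_cast; ring_nf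
  have hd : ModularForm.eta T ^ 2 * ModularForm.eta (4 * T) ^ 2 ≠ 0 := by
    rw [eta_eq, eta_eq, hpow4]
    have := qe_ne_zero (T / 24)
    have := qe_ne_zero (4 * T / 24)
    positivity
  rw [eq_div_iff hd, eta_eq, eta_eq, eta_eq, hpow4, hpow2, mul_pow _ B, hqe, hθ]
  linear_combination B * qe (T / 24) ^ 2 * qe (4 * T / 24) ^ 2 * (O * (A * C) + B * B) * key

/-! ### Inversion of the odd theta function and its reciprocal. -/

lemma im_neg_one_div_pos {τ : ℂ} (hτ : 0 < τ.im) : 0 < (-1 / τ).im := by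
  rw [neg_div, neg_im, one_div, inv_im, neg_div, neg_neg]
  exact div_pos hτ (normSq_pos.2 (ne_of_apply_ne im (by simpa using hτ.ne')))

lemma ne_zero_of_im_pos {τ : ℂ} (hτ : 0 < τ.im) : τ ≠ 0 :=
  ne_of_apply_ne im (by simpa using hτ.ne')

lemma qe_quarter : qe (1 / 4) = I := by
  rw [qe, show 2 * (Real.pi : ℂ) * I * (1 / 4) = Real.pi / 2 * I by ring, Complex.exp_pi_div_two_mul_I]

lemma sqrt_neg_I_mul_ne_zero {τ : ℂ} (hτ : 0 < τ.im) : (-I * τ) ^ (1 / 2 : ℂ) ≠ 0 := by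
  have := ne_zero_of_im_pos hτ
  simp [Complex.cpow_eq_zero_iff, this]

/-- The transformation of the odd theta function under `τ ↦ -1 / τ`. -/
theorem oddTheta_neg_one_div {τ : ℂ} (hτ : 0 < τ.im) (v : ℂ) :
    oddTheta (-1 / τ) (v / τ) =
      -I * (-I * τ) ^ (1 / 2 : ℂ) * qe (v ^ 2 / (2 * τ)) * oddTheta τ v := by
  have h0 := ne_zero_of_im_pos hτ
  have hs := sqrt_neg_I_mul_ne_zero hτ
  -- Division by τ exchanges the half-periods 1/2 and τ/2 up to the full period -1/τ.
  have h1 : jacobiTheta₂ (v / τ + 1 / 2 + -1 / τ / 2) (-1 / τ) =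
      qe (-(v / τ + 1 / 2)) * jacobiTheta₂ ((v + 1 / 2 + τ / 2) / τ) (-1 / τ) := by
    rw [show v / τ + 1 / 2 + -1 / τ / 2 = (v + 1 / 2 + τ / 2) / τ + -1 / τ by field_simp; ring,
      jacobiTheta₂_add_left']
    congr 1
    rw [qe]
    congr 1
    field_simp
    ring
  have h2 := jacobiTheta₂_functional_equation (v + 1 / 2 + τ / 2) τ
  rw [show cexp (-Real.pi * I * (v + 1 / 2 + τ / 2) ^ 2 / τ) =
    qe (-((v + 1 / 2 + τ / 2) ^ 2 / (2 * τ))) by rw [qe]; congr 1; field_simp] at h2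
  rw [oddTheta, oddTheta, h1, h2]
  set J := jacobiTheta₂ ((v + 1 / 2 + τ / 2) / τ) (-1 / τ)
  have h3 : qe (-1 / τ / 8 + v / τ / 2) * qe (-(v / τ + 1 / 2)) =
      -I * (qe (v ^ 2 / (2 * τ)) * qe (τ / 8 + v / 2) *
        qe (-((v + 1 / 2 + τ / 2) ^ 2 / (2 * τ)))) := by
    rw [← qe_quarter, neg_qe]
    simp only [← qe_add]
    refine qe_eq_of_sub_eq_intCast (-1) ?_
    push_cast
    field_simp
    ring
  rw [← mul_assoc, h3]
  field_simp

/-- Differentiate `oddTheta_neg_one_div` at v = 0. The derivative of the Gaussian factor drops out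
because `oddTheta` vanishes there. -/
lemma thetaConst_neg_one_div {τ : ℂ} (hτ : 0 < τ.im) :
    thetaConst (-1 / τ) = τ * (-I * (-I * τ) ^ (1 / 2 : ℂ)) * thetaConst τ := by
  have h0 := ne_zero_of_im_pos hτ
  have hf := (differentiable_oddTheta (im_neg_one_div_pos hτ) 0).hasDerivAt
  have hL : HasDerivAt (fun v => oddTheta (-1 / τ) (v / τ)) (deriv (oddTheta (-1 / τ)) 0 * (1 / τ))
      0 := by
    refine HasDerivAt.comp (h₂ := oddTheta (-1 / τ)) 0 ?_ ((hasDerivAt_id 0).div_const τ)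
    simpa using hf
  have hq : DifferentiableAt ℂ (fun v => qe (v ^ 2 / (2 * τ))) 0 :=
    differentiable_qe.differentiableAt.comp 0 (by fun_prop)
  have hR := ((hq.hasDerivAt.const_mul (-I * (-I * τ) ^ (1 / 2 : ℂ))).mul
    (differentiable_oddTheta hτ 0).hasDerivAt)
  have hLR := hL.congr_of_eventuallyEq (Eventually.of_forall fun v =>
    (oddTheta_neg_one_div hτ v).symm)
  have h := hLR.unique hR
  simp only [oddTheta_zero, mul_zero, zero_add] at h
  rw [show (0 : ℂ) ^ 2 / (2 * τ) = 0 by simp, qe_zero, mul_one, mul_one_div, div_eq_iff h0] at h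
  rw [thetaConst, thetaConst, h]
  ring

lemma OffLattice.neg_one_div {τ v : ℂ} (hτ : 0 < τ.im) (hv : OffLattice τ v) :
    OffLattice (-1 / τ) (v / τ) := by
  have h0 := ne_zero_of_im_pos hτ
  intro A B e
  refine hv (-B) A ?_
  rw [div_eq_iff h0, add_mul, mul_assoc, div_mul_cancel₀ _ h0] at e
  rw [e]; push_cast; ring

/-- The transformation of `thetaRecip` under `τ ↦ -1 / τ`. -/
theorem thetaRecip_neg_one_div {τ : ℂ} (hτ : 0 < τ.im) {v : ℂ} (hv : OffLattice τ v) :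
    thetaRecip (-1 / τ) (v / τ) = τ * qe (-(v ^ 2 / (2 * τ))) * thetaRecip τ v := by
  have h1 := thetaRecip_mul_oddTheta (im_neg_one_div_pos hτ) (hv.neg_one_div hτ)
  rw [thetaConst_neg_one_div hτ, ← thetaRecip_mul_oddTheta hτ hv, oddTheta_neg_one_div hτ] at h1
  have hc : -I * (-I * τ) ^ (1 / 2 : ℂ) ≠ 0 :=
    mul_ne_zero (neg_ne_zero.2 I_ne_zero) (sqrt_neg_I_mul_ne_zero hτ)
  have hθ := oddTheta_ne_zero hτ hv
  rw [qe_neg]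
  have hq := qe_ne_zero (v ^ 2 / (2 * τ))
  refine mul_left_cancel₀ (mul_ne_zero hc (mul_ne_zero hq hθ)) ?_
  calc _ = _ := by ring
    _ = _ := h1
    _ = _ := by field_simp

/-! ### Theta functions of degree m + 1/2. -/

lemma tsum_int_eq_sum_range {f : ℤ → ℂ} (hf : Summable f) {k : ℕ} (hk : k ≠ 0) :
    ∑' N, f N = ∑ r ∈ Finset.range k, ∑' l : ℤ, f (l * k + r) := by
  have : NeZero k := ⟨hk⟩
  rw [← (Int.divModEquiv k).symm.tsum_eq f,
    ← (Equiv.prodComm (Fin k) ℤ).tsum_eq (fun p => f ((Int.divModEquiv k).symm p)),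
    Summable.tsum_prod]
  · rw [tsum_fintype, ← Fin.sum_univ_eq_sum_range (fun r => ∑' l : ℤ, f (l * k + r))]
    simp
  · exact ((Equiv.prodComm (Fin k) ℤ).summable_iff.2 ((Int.divModEquiv k).symm.summable_iff.2 hf))

lemma theta_neg_one_eq (s m : ℝ) (τ z : ℂ) :
    theta (-1) s m τ z =
      ∑' j : ℤ, qe (j / 2 + m * (j + s / (2 * m)) * z + τ * (m * (j + s / (2 * m)) ^ 2)) := by
  refine tsum_congr fun j => ?_
  rw [neg_one_zpow_eq_qe, qPow_eq_qe, qe_add, qe_add]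
  congr 2
  · rw [qe]; ring_nf
  · push_cast; rfl

lemma theta_one_eq (s m : ℝ) (τ z : ℂ) :
    theta 1 s m τ z =
      ∑' j : ℤ, qe (m * (j + s / (2 * m)) * z + τ * (m * (j + s / (2 * m)) ^ 2)) := by
  refine tsum_congr fun j => ?_
  rw [one_zpow, one_mul, qPow_eq_qe, qe_add]
  congr 1
  · rw [qe]; ring_nf
  · push_cast; rfl

lemma two_mul_add_one_ne_zero (m : ℕ) : (2 * m + 1 : ℂ) ≠ 0 := by
  exact_mod_cast Nat.succ_ne_zero (2 * m)

/-- For s = m + 1/2 the shift s/(2(m + 1/2)) of the summation index is exactly 1/2. -/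
lemma theta_middle_eq_oddTheta (m : ℕ) (τ z : ℂ) :
    theta (-1) ((m : ℤ) + 1 / 2) (m + 1 / 2) τ z =
      oddTheta ((2 * m + 1) * τ) ((m + 1 / 2) * z) := by
  rw [theta_neg_one_eq, oddTheta_eq_tsum]
  refine tsum_congr fun j => ?_
  congr 1
  have := two_mul_add_one_ne_zero m
  push_cast
  have h : ((m : ℂ) + 1 / 2) / (2 * (m + 1 / 2)) = 1 / 2 := by
    rw [show (2 * ((m : ℂ) + 1 / 2)) = 2 * m + 1 by ring, div_eq_iff this]; ring
  rw [h]
  ring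

/-- Split the odd theta series by N = (2m+1)l + ν. Since 2m+1 is odd, (-1)^N = (-1)^ν (-1)^l. -/
lemma sum_theta_eq_oddTheta (m : ℕ) {τ : ℂ} (hτ : 0 < τ.im) (z : ℂ) :
    ∑ ν ∈ Finset.range (2 * m + 1), (-1 : ℂ) ^ ν * theta (-1) ((ν : ℤ) + 1 / 2) (m + 1 / 2) τ z =
      oddTheta (τ / (2 * m + 1)) (z / 2) := by
  have hm := two_mul_add_one_ne_zero m
  have him : 0 < (τ / (2 * m + 1) / 2).im := by
    rw [div_div, show (2 * m + 1 : ℂ) * 2 = ((2 * m + 1 : ℕ) * 2 : ℕ) by push_cast; ring, div_natCast_im]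
    positivity
  rw [oddTheta_eq_tsum, tsum_int_eq_sum_range (k := 2 * m + 1) _ (by omega)]
  · refine Finset.sum_congr rfl fun ν _ => ?_
    rw [theta_neg_one_eq, ← tsum_mul_left]
    refine tsum_congr fun l => ?_
    rw [neg_one_pow_eq_qe, ← qe_add]
    refine qe_eq_of_sub_eq_intCast (-(l * m)) ?_
    push_cast
    rw [show (2 * ((m : ℂ) + 1 / 2)) = 2 * m + 1 by ring]
    field_simp
    ring
  · refine (summable_qe_quadratic him (τ / (2 * m + 1) / 2 + z / 2 + 1 / 2)
      (τ / (2 * m + 1) / 8 + z / 4)).congr fun N => ?_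
    ring_nf

/-! ### Absolute convergence of the indefinite series. -/

lemma summable_pow_natAbs {r : ℝ} (h0 : 0 ≤ r) (h1 : r < 1) : Summable fun j : ℤ => r ^ j.natAbs := by
  refine Summable.of_nat_of_neg ?_ ?_ <;>
  simpa using summable_geometric_of_lt_one h0 h1

lemma summable_qPow_of_le {τ : ℂ} (hτ : 0 < τ.im) (S : Set (ℤ × ℤ)) (Q : ℤ × ℤ → ℝ) {a : ℝ}
    (C : ℝ) (ha : 0 < a) (hQ : ∀ x ∈ S, a * (|(x.1 : ℝ)| + |(x.2 : ℝ)|) - C ≤ Q x) :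
    Summable fun x : S => qPow τ (Q x) := by
  set y := 2 * Real.pi * τ.im
  have hy : 0 < y := by positivity
  have hr1 : Real.exp (-(y * a)) < 1 := Real.exp_lt_one_iff.2 (by nlinarith)
  have hs := summable_pow_natAbs (Real.exp_pos _).le hr1
  have hp := ((hs.mul_of_nonneg hs (fun _ => by positivity) (fun _ => by positivity)).mul_left
    (Real.exp (y * C))).comp_injective (Subtype.val_injective (p := (· ∈ S)))
  refine Summable.of_norm_bounded hp fun x => ?_
  rw [norm_qPow, Function.comp_apply, ← Real.exp_nat_mul, ← Real.exp_nat_mul, ← Real.exp_add,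
    ← Real.exp_add, Real.exp_le_exp]
  have h := mul_le_mul_of_nonneg_left (hQ x x.2) hy.le
  have h1 : ((x.1.1.natAbs : ℕ) : ℝ) = |(x.1.1 : ℝ)| := by
    rw [Nat.cast_natAbs, Int.cast_abs]
  have h2 : ((x.1.2.natAbs : ℕ) : ℝ) = |(x.1.2 : ℝ)| := by
    rw [Nat.cast_natAbs, Int.cast_abs]
  rw [h1, h2]
  change -(y * Q x) ≤ _
  linarith

/-- When |p| ≤ |j| the form keeps a surplus j²/2, which dominates the linear terms; the constant
comes from completing the square in |j|. -/
lemma gExponent_bound {m : ℝ} (hm : 0 ≤ m) (c d j p : ℝ) (h : |p| ≤ |j|) :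
    1 / 2 * (|j| + |p|) - (((2 * m + 1) * |c| + 2 * m * |d| + 1) ^ 2 / 2 + m * d ^ 2) ≤
      (m + 1 / 2) * (j + c) ^ 2 - m * (p + d) ^ 2 := by
  have hp : p ^ 2 ≤ j ^ 2 := sq_le_sq.2 h
  have h1 : -(|c| * |j|) ≤ c * j := by
    rw [← abs_mul]; exact neg_abs_le _
  have h2 : d * p ≤ |d| * |j| := by
    refine (le_abs_self _).trans ?_
    rw [abs_mul]; gcongr
  have h3 := sq_abs j
  have h4 : m * p ^ 2 ≤ m * j ^ 2 := by gcongr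
  have h5 : m * (d * p) ≤ m * (|d| * |j|) := by gcongr
  have h6 : (2 * m + 1) * -(|c| * |j|) ≤ (2 * m + 1) * (c * j) := by gcongr
  have h7 : 0 ≤ (m + 1 / 2) * c ^ 2 := by positivity
  nlinarith [sq_nonneg (|j| - ((2 * m + 1) * |c| + 2 * m * |d| + 1))]

lemma summable_gTerm {τ : ℂ} (hτ : 0 < τ.im) {m : ℝ} (hm : 0 ≤ m) (n ν : ℤ) (S : Set (ℤ × ℤ))
    (hS : ∀ x ∈ S, |x.2| ≤ |x.1|) : Summable fun x : S => gTerm m n ν τ x := by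
  refine Summable.of_norm ?_
  have h := (summable_qPow_of_le hτ S (fun x =>
    ((m + 1 / 2) * ((x.1 : ℝ) + (ν : ℝ) - ((ν : ℝ) + 1 / 2) / (2 * (m + 1 / 2))) ^ 2
        - m * ((x.2 : ℝ) + (ν : ℝ) - (n : ℝ) / (2 * m)) ^ 2)) (a := 1 / 2)
    (((2 * m + 1) * |ν - ((ν : ℝ) + 1 / 2) / (2 * (m + 1 / 2))| +
      2 * m * |ν - (n : ℝ) / (2 * m)| + 1) ^ 2 / 2 + m * (ν - (n : ℝ) / (2 * m)) ^ 2)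
    (by norm_num) fun x hx => ?_).norm
  · refine h.congr fun x => ?_
    rw [gTerm, norm_mul]; simp
  · have := gExponent_bound hm (ν - ((ν : ℝ) + 1 / 2) / (2 * (m + 1 / 2)))
      (ν - (n : ℝ) / (2 * m)) x.1 x.2 (by exact_mod_cast hS x hx)
    simp only [← add_sub_assoc] at this
    simpa only [← add_sub_assoc] using this

lemma summable_gTerm_gPos {τ : ℂ} (hτ : 0 < τ.im) {m : ℝ} (hm : 0 ≤ m) (n ν : ℤ) :
    Summable fun x : gPos => gTerm m n ν τ x := by
  refine summable_gTerm hτ hm n ν _ fun x hx => ?_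
  obtain ⟨h1, h2⟩ := hx
  rw [abs_of_pos h1, abs_of_pos (h1.trans_le h2)]
  exact h2

lemma summable_gTerm_gNeg {τ : ℂ} (hτ : 0 < τ.im) {m : ℝ} (hm : 0 ≤ m) (n ν : ℤ) :
    Summable fun x : gNeg => gTerm m n ν τ x := by
  refine summable_gTerm hτ hm n ν _ fun x hx => ?_
  obtain ⟨h1, h2⟩ := hx
  rw [abs_of_nonpos h2, abs_of_nonpos (h1.le.trans h2)]
  omega

lemma summable_dTerm_dPos {τ : ℂ} (hτ : 0 < τ.im) {m : ℝ} (hm : 0 < m) {n ν : ℤ} (hn : 0 ≤ n)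
    (hn' : (n : ℝ) < 2 * m) (hν : 0 ≤ ν) : Summable fun x : dPos => dTerm m n ν τ x := by
  have hc0 : 0 ≤ (n : ℝ) / (2 * m) := by positivity
  have hc1 : (n : ℝ) / (2 * m) < 1 := (div_lt_one (by positivity)).2 hn'
  set c := (n : ℝ) / (2 * m) with hc
  have hν' : (0 : ℝ) ≤ ν := by exact_mod_cast hν
  refine summable_qPow_of_le hτ dPos (fun x =>
    (m * ((x.1 : ℝ) - (ν : ℝ)) ^ 2 - m * ((x.2 : ℝ) - (ν : ℝ) + c) ^ 2)) (a := m * (1 - c))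
    (m * (4 * ν ^ 2 + 2 * ν)) (mul_pos hm (by linarith)) fun x hx => ?_
  obtain ⟨h1, h2⟩ := hx
  have h1' : (x.2 : ℝ) + 1 ≤ x.1 := by exact_mod_cast h1
  have h2' : (0 : ℝ) ≤ x.2 := by exact_mod_cast h2
  rw [abs_of_nonneg h2', abs_of_nonneg (by linarith)]
  have hw : 1 - c ≤ (x.1 : ℝ) - x.2 - c := by linarith
  -- The exponent is m times a product of two linear factors. The first is at least 1 - c; the
  -- second can be negative only for j + k < 2ν - c, and the constant absorbs that range.
  have key : (1 - c) * (x.1 + x.2) - (4 * ν ^ 2 + 2 * ν) ≤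
      ((x.1 : ℝ) - x.2 - c) * (x.1 + x.2 - 2 * ν + c) := by
    rcases le_total (2 * ν - c) ((x.1 : ℝ) + x.2) with hs | hs
    · have := mul_le_mul_of_nonneg_right hw (by linarith : 0 ≤ (x.1 : ℝ) + x.2 - 2 * ν + c)
      nlinarith
    · nlinarith [mul_nonneg (by linarith : 0 ≤ (x.1 : ℝ) - x.2 - c)
        (by linarith : 0 ≤ (x.1 : ℝ) + x.2 + c), mul_nonneg hc0 hν']
  have := mul_le_mul_of_nonneg_left key hm.le
  linarith

lemma summable_dTerm_dNeg {τ : ℂ} (hτ : 0 < τ.im) {m : ℝ} (hm : 0 < m) {n ν : ℤ} (hn : 0 ≤ n)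
    (hn' : (n : ℝ) < 2 * m) (hν : 0 ≤ ν) : Summable fun x : dNeg n => dTerm m n ν τ x := by
  have hc0 : 0 ≤ (n : ℝ) / (2 * m) := by positivity
  have hc1 : (n : ℝ) / (2 * m) < 1 := (div_lt_one (by positivity)).2 hn'
  have hcn : n ≠ 0 → 0 < (n : ℝ) / (2 * m) := fun h => by
    have : (0 : ℝ) < n := by exact_mod_cast lt_of_le_of_ne hn h.symm
    positivity
  set c := (n : ℝ) / (2 * m) with hc
  have hν' : (0 : ℝ) ≤ ν := by exact_mod_cast hν
  -- A lower bound for the factor c + k - j: on the diagonal it equals c, which vanishes for n = 0,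
  -- but there the diagonal is excluded.
  set ε : ℝ := if n = 0 then 1 else c with hε
  have hε0 : 0 < ε := by
    rw [hε]; split_ifs with h
    · norm_num
    · exact hcn h
  refine summable_qPow_of_le hτ (dNeg n) (fun x =>
    (m * ((x.1 : ℝ) - (ν : ℝ)) ^ 2 - m * ((x.2 : ℝ) - (ν : ℝ) + c) ^ 2)) (a := m * ε / 2)
    0 (by positivity) fun x hx => ?_
  obtain ⟨h1, h2, h3⟩ := hx
  have h1' : (x.1 : ℝ) ≤ x.2 := by exact_mod_cast h1
  have h2' : (x.2 : ℝ) ≤ -1 := by exact_mod_cast Int.le_sub_one_of_lt h2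
  rw [abs_of_nonpos (by linarith), abs_of_nonpos (by linarith)]
  have hw : ε ≤ c + (x.2 - x.1) := by
    rw [hε]; split_ifs with h
    · have : (x.1 : ℝ) + 1 ≤ x.2 := by exact_mod_cast lt_of_le_of_ne h1 (h3 h)
      linarith
    · linarith
  have key := mul_le_mul hw (by linarith : (-(x.1 : ℝ) + -x.2) / 2 ≤ -x.1 - x.2 + 2 * ν - c)
    (by linarith) (hε0.le.trans hw)
  have := mul_le_mul_of_nonneg_left key hm.le
  linarith

/-! ### Telescoping: G as a single series. -/

lemma hasSum_of_gCones {F : ℤ × ℤ → ℂ} (hP : Summable fun x : gPos => F x)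
    (hN : Summable fun x : gNeg => F x) :
    HasSum (fun j : ℤ => ∑ p ∈ Finset.Icc 1 j, F (j, p) - ∑ p ∈ Finset.Icc (j + 1) 0, F (j, p))
      ((∑' x : gPos, F x) - ∑' x : gNeg, F x) := by
  rw [← Function.comp_def F, summable_subtype_iff_indicator] at hP hN
  rw [tsum_subtype, tsum_subtype]
  refine HasSum.sub ?_ ?_
  · refine hP.hasSum.prod_fiberwise fun j => ?_
    convert hasSum_sum_of_ne_finset_zero (s := Finset.Icc 1 j) (f := fun p => gPos.indicator F (j, p))
      fun p hp => ?_ using 1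
    · refine Finset.sum_congr rfl fun p hp => ?_
      rw [Finset.mem_Icc] at hp
      exact (Set.indicator_of_mem (s := gPos) (show 0 < p ∧ p ≤ j by omega) F).symm
    · rw [Finset.mem_Icc] at hp
      exact Set.indicator_of_notMem (s := gPos) (fun h : 0 < p ∧ p ≤ j => hp (by omega)) F
    · infer_instance
  · refine hN.hasSum.prod_fiberwise fun j => ?_
    convert hasSum_sum_of_ne_finset_zero (s := Finset.Icc (j + 1) 0)
      (f := fun p => gNeg.indicator F (j, p)) fun p hp => ?_ using 1
    · refine Finset.sum_congr rfl fun p hp => ?_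
      rw [Finset.mem_Icc] at hp
      exact (Set.indicator_of_mem (s := gNeg) (show j < p ∧ p ≤ 0 by omega) F).symm
    · rw [Finset.mem_Icc] at hp
      exact Set.indicator_of_notMem (s := gNeg) (fun h : j < p ∧ p ≤ 0 => hp (by omega)) F
    · infer_instance

/-- The two signed cones of `g` combine, for fixed j, into one oriented sum from 0 to j, so
telescoping works for j of either sign. -/
lemma oriented_sum_eq {f U : ℤ → ℂ} (h : ∀ p, U p - U (p - 1) = f p) (j : ℤ) :
    ∑ p ∈ Finset.Icc 1 j, f p - ∑ p ∈ Finset.Icc (j + 1) 0, f p = U j - U 0 := by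
  induction j using Int.induction_on with
  | zero => simp
  | succ i ih =>
    have h1 : Finset.Icc (1 : ℤ) (i + 1) = insert ((i : ℤ) + 1) (Finset.Icc 1 (i : ℤ)) := by
      ext p; simp only [Finset.mem_Icc, Finset.mem_insert]; omega
    have h2 : Finset.Icc ((i : ℤ) + 1) 0 = ∅ := Finset.Icc_eq_empty (by omega)
    have h3 : Finset.Icc ((i : ℤ) + 1 + 1) 0 = ∅ := Finset.Icc_eq_empty (by omega)
    rw [h2] at ih
    rw [h1, h3, Finset.sum_insert (by simp)]
    have := h (i + 1)
    rw [add_sub_cancel_right] at this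
    simp only [Finset.sum_empty] at ih ⊢
    linear_combination ih - this
  | pred i ih =>
    have h1 : Finset.Icc (-(i : ℤ) - 1 + 1) 0 = insert (-(i : ℤ)) (Finset.Icc (-(i : ℤ) + 1) 0) := by
      ext p; simp only [Finset.mem_Icc, Finset.mem_insert]; omega
    have h2 : Finset.Icc 1 (-(i : ℤ)) = ∅ := Finset.Icc_eq_empty (by omega)
    have h3 : Finset.Icc 1 (-(i : ℤ) - 1) = ∅ := Finset.Icc_eq_empty (by omega)
    rw [h2] at ih
    rw [h1, h3, Finset.sum_insert (by simp)]
    have := h (-i)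
    simp only [Finset.sum_empty] at ih ⊢
    linear_combination ih + this

/-- The function `q ^ (-m J ^ 2) h^{[m]}_{n,J}`. -/
noncomputable def hNorm (m n : ℕ) (J : ℤ) (τ z : ℂ) : ℂ :=
  ∑' l : ℤ, qe (m * l * z + τ * (m * l ^ 2 - m * J ^ 2) + n * (z / 2 + (l + J) * τ)) /
    (1 - qe (m * z + ((2 * m * (l + J) : ℤ) : ℂ) * τ))

lemma qPow_mul_h (m n : ℕ) (J : ℤ) (τ z : ℂ) :
    qPow τ (-m * (J : ℝ) ^ 2) * h m n J τ z = hNorm m n J τ z := by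
  rw [h, hNorm, ← tsum_mul_left]
  refine tsum_congr fun l => ?_
  rw [← mul_div_assoc]
  simp only [qPow_eq_qe, ofReal_natCast]
  rw [show cexp (2 * (Real.pi : ℂ) * I * (m : ℂ) * z) = qe (m * z) by rw [qe]; ring_nf,
    show cexp (2 * (Real.pi : ℂ) * I * (m : ℂ) * (l : ℂ) * z
        + (Real.pi : ℂ) * I * ((n : ℤ) : ℂ) * z) = qe (m * l * z + n * z / 2) by
      rw [qe]; push_cast; ring_nf, ← qe_add, ← qe_add, ← qe_add]
  push_cast
  ring_nf

lemma summable_hNorm_num {m : ℕ} (hm : 0 < m) (n : ℕ) (J : ℤ) {τ : ℂ} (hτ : 0 < τ.im) (z : ℂ) :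
    Summable fun l : ℤ =>
      qe (m * l * z + τ * (m * l ^ 2 - m * J ^ 2) + n * (z / 2 + (l + J) * τ)) := by
  refine (summable_qe_quadratic (a := m * τ) ?_ (m * z + n * τ)
    (-τ * m * J ^ 2 + n * (z / 2 + J * τ))).congr fun l => ?_
  · rw [← ofReal_natCast, im_ofReal_mul]; positivity
  · ring_nf

lemma summable_hNorm {m : ℕ} (hm : 0 < m) (n : ℕ) (J : ℤ) {τ : ℂ} (hτ : 0 < τ.im) {z : ℂ}
    (hz : OffLattice τ (m * z)) : Summable fun l : ℤ =>
      qe (m * l * z + τ * (m * l ^ 2 - m * J ^ 2) + n * (z / 2 + (l + J) * τ)) /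
        (1 - qe (m * z + ((2 * m * (l + J) : ℤ) : ℂ) * τ)) := by
  obtain ⟨δ, hδ, h⟩ := hz.exists_le_norm hτ
  exact summable_div_one_sub (summable_hNorm_num hm n J hτ z) _ hδ fun l => h _

/-- After l ↦ l + 1 in the second series the denominators agree, and the numerators differ by
exactly the denominator. What remains is one p-factor of `gTerm` times θ_{n,m}. -/
lemma hNorm_sub {m : ℕ} (hm : 0 < m) (n : ℕ) (J : ℤ) {τ : ℂ} (hτ : 0 < τ.im) {z : ℂ}
    (hz : OffLattice τ (m * z)) :
    hNorm m n J τ z - hNorm m n (J - 1) τ z =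
      qPow τ (-(m * ((J : ℝ) - ((n : ℤ) : ℝ) / (2 * m)) ^ 2)) * theta 1 ((n : ℤ) : ℝ) m τ z := by
  have hm' : (m : ℂ) ≠ 0 := by exact_mod_cast hm.ne'
  have hs := (Equiv.addRight (1 : ℤ)).summable_iff.2 (summable_hNorm hm n (J - 1) hτ hz)
  rw [Function.comp_def] at hs
  rw [theta_one_eq, ← tsum_mul_left, hNorm, hNorm,
    ← (Equiv.addRight (1 : ℤ)).tsum_eq (fun l : ℤ =>
      qe (m * l * z + τ * (m * l ^ 2 - m * ((J - 1 : ℤ) : ℂ) ^ 2) +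
        n * (z / 2 + (l + (J - 1 : ℤ)) * τ)) /
        (1 - qe (m * z + ((2 * m * (l + (J - 1)) : ℤ) : ℂ) * τ))),
    ← (summable_hNorm hm n J hτ hz).tsum_sub hs]
  refine tsum_congr fun l => ?_
  rw [Equiv.coe_addRight, show 2 * (m : ℤ) * (l + 1 + (J - 1)) = 2 * m * (l + J) by ring,
    ← sub_div, div_eq_iff (hz.one_sub_ne_zero _), mul_one_sub, qPow_eq_qe]
  simp only [← qe_add]
  congr 2 <;>
  · push_cast
    field_simp
    ring

lemma two_mul_add_half_ne_zero (m : ℕ) : (2 * (m + 1 / 2) : ℂ) ≠ 0 := by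
  have := two_mul_add_one_ne_zero m
  intro e
  refine this ?_
  linear_combination e

/-- `G^{[m]}_{n,ν}` as a single series in the functions `q ^ (-m J ^ 2) h^{[m]}_{n,J}`. -/
lemma G_hasSum {m : ℕ} (hm : 0 < m) (n : ℕ) (ν : ℤ) {τ : ℂ} (hτ : 0 < τ.im) {z : ℂ}
    (hz : OffLattice τ (m * z)) :
    HasSum (fun J : ℤ => qe ((J - ν) / 2 + τ * ((m + 1 / 2) *
      (J - (ν + 1 / 2) / (2 * (m + 1 / 2))) ^ 2)) * hNorm m n J τ z) (G m n ν τ z) := by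
  have h2 := two_mul_add_half_ne_zero m
  set α : ℂ := (ν + 1 / 2) / (2 * (m + 1 / 2)) with hα
  set c : ℤ → ℂ := fun J => qe ((J - ν) / 2 + τ * ((m + 1 / 2) * (J - α) ^ 2)) with hc
  have hg := (hasSum_of_gCones (summable_gTerm_gPos hτ (Nat.cast_nonneg m) n ν)
    (summable_gTerm_gNeg hτ (Nat.cast_nonneg m) n ν)).mul_right (theta 1 ((n : ℤ) : ℝ) m τ z)
  have hg' : HasSum (fun j : ℤ => c (j + ν) * (hNorm m n (j + ν) τ z - hNorm m n ν τ z))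
      (g m n ν τ * theta 1 ((n : ℤ) : ℝ) m τ z) := by
    refine hg.congr_fun fun j => ?_
    have ho := oriented_sum_eq (U := fun p => hNorm m n (p + ν) τ z)
      (f := fun p => qPow τ (-(m * (((p + ν : ℤ) : ℝ) - ((n : ℤ) : ℝ) / (2 * m)) ^ 2)) *
        theta 1 ((n : ℤ) : ℝ) m τ z) (fun p => by
          rw [← hNorm_sub hm n (p + ν) hτ hz, show p - 1 + ν = p + ν - 1 by ring]) j
    rw [zero_add] at ho
    rw [← ho, mul_sub, sub_mul, Finset.mul_sum, Finset.mul_sum, Finset.sum_mul, Finset.sum_mul]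
    have : ∀ p : ℤ, gTerm m n ν τ (j, p) * theta 1 ((n : ℤ) : ℝ) m τ z =
        c (j + ν) * (qPow τ (-(m * (((p + ν : ℤ) : ℝ) - ((n : ℤ) : ℝ) / (2 * m)) ^ 2)) *
        theta 1 ((n : ℤ) : ℝ) m τ z) := by
      intro p
      rw [gTerm, ← mul_assoc, neg_one_zpow_eq_qe, qPow_eq_qe, qPow_eq_qe, hc, ← qe_add, ← qe_add]
      congr 2
      rw [hα]
      push_cast
      ring
    simp only [this]
  have hθ : HasSum (fun j : ℤ => c (j + ν) * hNorm m n ν τ z)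
      ((-1 : ℂ) ^ ν * qPow τ (-m * (ν : ℝ) ^ 2) * theta (-1) ((ν : ℝ) + 1 / 2) (m + 1 / 2) τ 0 *
        h m n ν τ z) := by
    have hs : Summable fun j : ℤ => qe (j / 2 + (m + 1 / 2 : ℂ) * (j + α) * 0 +
        τ * ((m + 1 / 2) * (j + α) ^ 2)) := by
      refine (summable_qe_quadratic (a := (m + 1 / 2) * τ) ?_ (1 / 2 + 2 * (m + 1 / 2) * τ * α)
        (τ * ((m + 1 / 2) * α ^ 2))).congr fun j => ?_
      · rw [show ((m : ℂ) + 1 / 2) = ((m + 1 / 2 : ℝ) : ℂ) by push_cast; rfl, im_ofReal_mul]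
        positivity
      · ring_nf
    -- The theta series is centred at -α and the coefficients c at α; the reflection j ↦ -ν - j
    -- matches them.
    have h1 := ((((Equiv.subLeft (-ν)).hasSum_iff.2 hs.hasSum).mul_left
      ((-1 : ℂ) ^ ν)).mul_right (hNorm m n ν τ z))
    rw [show (-1 : ℂ) ^ ν * qPow τ (-m * (ν : ℝ) ^ 2) *
      theta (-1) ((ν : ℝ) + 1 / 2) (m + 1 / 2) τ 0 * h m n ν τ z = (-1 : ℂ) ^ ν *
      theta (-1) ((ν : ℝ) + 1 / 2) (m + 1 / 2) τ 0 * hNorm m n ν τ z by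
        rw [← qPow_mul_h]; ring, theta_neg_one_eq]
    push_cast
    refine h1.congr_fun fun j => ?_
    rw [Function.comp_apply, Equiv.subLeft_apply, neg_one_zpow_eq_qe, ← qe_add, hc]
    congr 1
    refine qe_eq_of_sub_eq_intCast j ?_
    push_cast
    ring
  -- The term with `hNorm` at ν is the lower endpoint of the telescoping, and the second part of G
  -- cancels it.
  have hsum := hg'.add hθ
  rw [← (Equiv.addRight ν).hasSum_iff]
  refine hsum.congr_fun fun j => ?_
  rw [Function.comp_apply, Equiv.coe_addRight]
  change c (j + ν) * _ = _
  ring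

/-! ### Partial fractions and quotients of theta functions. -/

lemma sum_range_qe_div {N : ℕ} (hN : 0 < N) {n r : ℕ} (hn : n < N) (hr : r < N) :
    ∑ b ∈ Finset.range N, qe (b * ((n - r : ℂ) / N)) = if n = r then (N : ℂ) else 0 := by
  have hN' : (N : ℂ) ≠ 0 := by exact_mod_cast hN.ne'
  split_ifs with h
  · simp [h]
  · have h1 : qe ((n - r : ℂ) / N) ≠ 1 := by
      intro e
      obtain ⟨k, hk⟩ := qe_eq_one_iff.1 e
      rw [div_eq_iff hN'] at hk
      have hk' : (n : ℤ) - r = k * N := by exact_mod_cast hk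
      have hk0 : k = 0 := by
        by_contra hk0
        rcases lt_or_gt_of_ne hk0 with h0 | h0 <;> nlinarith
      rw [hk0] at hk'
      omega
    simp only [qe_natCast_mul]
    have h2 := geom_sum_mul (qe ((n - r : ℂ) / N)) N
    rw [← qe_natCast_mul, mul_div_cancel₀ _ hN', show (n - r : ℂ) = ((n - r : ℤ) : ℂ) by push_cast; rfl,
      qe_intCast, sub_self] at h2
    push_cast at h2 ⊢
    exact (mul_eq_zero.1 h2).resolve_right (sub_ne_zero.2 h1)

/-- Partial fractions of x^n/(1 - x^N) over the N-th roots of unity: expand each summand as a finite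
geometric sum and use orthogonality, where n < N selects the single exponent r = n. -/
lemma qe_div_one_sub_eq_sum {N : ℕ} (hN : 0 < N) {n : ℕ} (hn : n < N) {w : ℂ} (hw : qe (N * w) ≠ 1) :
    qe (n * w) / (1 - qe (N * w)) =
      (1 / N) * ∑ b ∈ Finset.range N, qe (b * n / N) * (1 / (1 - qe (w - b / N))) := by
  have hN' : (N : ℂ) ≠ 0 := by exact_mod_cast hN.ne'
  have hw' : 1 - qe (N * w) ≠ 0 := sub_ne_zero.2 hw.symm
  have h1 : ∀ b : ℕ, 1 / (1 - qe (w - b / N)) =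
      (∑ r ∈ Finset.range N, qe (r * (w - b / N))) / (1 - qe (N * w)) := by
    intro b
    have h2 := geom_sum_mul (qe (w - b / N)) N
    have h3 : qe (w - b / N) ^ N = qe (N * w) := by
      rw [← qe_natCast_mul]
      refine qe_eq_of_sub_eq_intCast (-b) ?_
      push_cast
      field_simp
      ring
    rw [h3] at h2
    simp only [← qe_natCast_mul] at h2
    have h4 : 1 - qe (w - b / N) ≠ 0 := by
      intro h0
      refine hw ?_
      rw [← h3, ← sub_eq_zero.1 h0, one_pow]
    rw [div_eq_div_iff h4 hw']
    linear_combination h2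
  simp only [h1, mul_div_assoc', ← Finset.sum_div, Finset.mul_sum]
  congr 1
  rw [Finset.sum_comm]
  have h5 : ∀ r ∈ Finset.range N, ∑ b ∈ Finset.range N,
      1 / (N : ℂ) * (qe (b * n / N) * qe (r * (w - b / N))) = if n = r then qe (r * w) else 0 := by
    intro r hr
    have h6 : ∀ b : ℕ, 1 / (N : ℂ) * (qe (b * n / N) * qe (r * (w - b / N))) =
        qe (r * w) * (1 / N) * qe (b * ((n - r : ℂ) / N)) := by
      intro b
      rw [← qe_add, mul_comm (qe (r * w)), mul_assoc, ← qe_add]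
      congr 2
      field_simp
      ring
    simp only [h6]
    rw [← Finset.mul_sum, sum_range_qe_div hN hn (Finset.mem_range.1 hr)]
    split_ifs
    · field_simp
    · simp
  rw [Finset.sum_congr rfl h5, Finset.sum_ite_eq, if_pos (Finset.mem_range.2 hn)]

/-- The Appell sum `∑_l e ^ (2 π i m l Z) q ^ (m l ^ 2 - m J ^ 2) / (1 - e ^ (π i Z) q ^ (l + J))`. -/
noncomputable def appellShift (m : ℕ) (J : ℤ) (τ Z : ℂ) : ℂ :=
  ∑' l : ℤ, qe (m * l * Z + τ * (m * l ^ 2 - m * J ^ 2)) / (1 - qe (Z / 2 + ((l + J : ℤ) : ℂ) * τ))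

lemma summable_appellShift {m : ℕ} (hm : 0 < m) (J : ℤ) {τ : ℂ} (hτ : 0 < τ.im) {Z : ℂ}
    (hZ : OffLattice τ (Z / 2)) : Summable fun l : ℤ =>
      qe (m * l * Z + τ * (m * l ^ 2 - m * J ^ 2)) / (1 - qe (Z / 2 + ((l + J : ℤ) : ℂ) * τ)) := by
  obtain ⟨δ, hδ, h⟩ := hZ.exists_le_norm hτ
  refine summable_div_one_sub ?_ _ hδ fun l => h _
  refine (summable_qe_quadratic (a := m * τ) ?_ (m * Z) (-τ * m * J ^ 2)).congr fun l => ?_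
  · rw [← ofReal_natCast, im_ofReal_mul]; positivity
  · ring_nf

lemma OffLattice.half_sub {m : ℕ} (hm : 0 < m) {τ z : ℂ} (hz : OffLattice τ (m * z)) (b : ℕ) :
    OffLattice τ ((z - b / m) / 2) := by
  have hm' : (m : ℂ) ≠ 0 := by exact_mod_cast hm.ne'
  intro A B e
  refine hz (b + 2 * m * A) (2 * m * B) ?_
  have : z = b / m + 2 * (A + B * τ) := by rw [← e]; ring
  rw [this]
  push_cast
  field_simp
  ring

/-- Termwise partial fractions with N = 2m. The factor e^{2πimlz} is unchanged by z ↦ z - b/m, so n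
survives only in the character. -/
lemma hNorm_eq_sum {m : ℕ} (hm : 0 < m) {n : ℕ} (hn : n < 2 * m) (J : ℤ) {τ : ℂ} (hτ : 0 < τ.im)
    {z : ℂ} (hz : OffLattice τ (m * z)) :
    hNorm m n J τ z = (1 / (2 * m : ℂ)) * ∑ b ∈ Finset.range (2 * m), qe (b * n / (2 * m)) *
      appellShift m J τ (z - b / m) := by
  have hm' : (m : ℂ) ≠ 0 := by exact_mod_cast hm.ne'
  have hb : ∀ b : ℕ, OffLattice τ ((z - b / m) / 2) := hz.half_sub hm
  simp only [appellShift, ← tsum_mul_left]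
  rw [← Summable.tsum_finsetSum
    (fun b _ => (summable_appellShift hm J hτ (hb b)).mul_left _), ← tsum_mul_left, hNorm]
  refine tsum_congr fun l => ?_
  have hw : qe (((2 * m : ℕ) : ℂ) * (z / 2 + (l + J) * τ)) ≠ 1 := by
    have := hz.qe_ne_one (2 * m * (l + J))
    convert this using 2
    push_cast
    ring
  have h := qe_div_one_sub_eq_sum (by omega) hn hw
  have h1 : qe (m * z + ((2 * m * (l + J) : ℤ) : ℂ) * τ) =
      qe (((2 * m : ℕ) : ℂ) * (z / 2 + (l + J) * τ)) := by
    congr 1; push_cast; ring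
  rw [qe_add (_ + _), h1, mul_div_assoc, h, mul_left_comm, Finset.mul_sum]
  push_cast
  congr 1
  refine Finset.sum_congr rfl fun b _ => ?_
  have h2 : qe (m * l * z + τ * (m * l ^ 2 - m * J ^ 2)) =
      qe (m * l * (z - b / m) + τ * (m * l ^ 2 - m * J ^ 2)) := by
    refine qe_eq_of_sub_eq_intCast (l * b) ?_
    push_cast
    field_simp
    ring
  have h3 : qe (z / 2 + (l + J) * τ - b / (2 * m)) = qe ((z - b / m) / 2 + (l + J) * τ) := by
    congr 1; field_simp; ring
  rw [h2, h3]
  ring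

/-- The products of a reciprocal theta function and a theta function of degree `m + 1 / 2`
whose components are the functions `G^{[m]}_{n,ν}`. -/
noncomputable def thetaQuot (m : ℕ) (ν : ℤ) (τ Z : ℂ) : ℂ :=
  (-1 : ℂ) ^ ν * thetaRecip τ (Z / 2) * theta (-1) ((ν : ℝ) + 1 / 2) (m + 1 / 2) τ Z

/-- The quadratic part of the exponent is (m + 1/2)J² - mJ² + ml² = J²/2 + ml², positive definite,
so the order may be exchanged. For fixed l and k = J + l the inner sum is an Appell sum with
parameter ν + l; `appell_eq` extracts the reciprocal theta function, and the sum over l is the theta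
function of degree m + 1/2. -/
lemma hasSum_appellShift {m : ℕ} (hm : 0 < m) (ν : ℤ) {τ : ℂ} (hτ : 0 < τ.im) {Z : ℂ}
    (hZ : OffLattice τ (Z / 2)) :
    HasSum (fun J : ℤ => qe ((J - ν) / 2 + τ * ((m + 1 / 2) *
      (J - (ν + 1 / 2) / (2 * (m + 1 / 2))) ^ 2)) * appellShift m J τ Z) (thetaQuot m ν τ Z) := by
  have h2 := two_mul_add_half_ne_zero m
  set α : ℂ := (ν + 1 / 2) / (2 * (m + 1 / 2)) with hα
  have hα' : 2 * (m + 1 / 2) * α = ν + 1 / 2 := mul_div_cancel₀ _ h2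
  set F : ℤ × ℤ → ℂ := fun x => qe ((x.1 - ν) / 2 + τ * ((m + 1 / 2) * (x.1 - α) ^ 2)) *
    (qe (m * x.2 * Z + τ * (m * x.2 ^ 2 - m * x.1 ^ 2)) /
      (1 - qe (Z / 2 + ((x.2 + x.1 : ℤ) : ℂ) * τ))) with hF
  have hS : Summable F := by
    obtain ⟨δ, hδ, h⟩ := hZ.exists_le_norm hτ
    have hs1 := summable_qe_quadratic (a := τ / 2) (by simpa using hτ)
      (1 / 2 - τ * (ν + 1 / 2)) (-ν / 2 + τ * (m + 1 / 2) * α ^ 2)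
    have hs2 := summable_qe_quadratic (a := m * τ)
      (by rw [← ofReal_natCast, im_ofReal_mul]; positivity) (m * Z) 0
    refine (summable_div_one_sub (summable_mul_of_summable_norm hs1.norm hs2.norm) _ hδ
      fun x : ℤ × ℤ => h (x.2 + x.1)).congr fun x => ?_
    simp only [hF]
    rw [← mul_div_assoc, ← qe_add, ← qe_add]
    congr 2
    linear_combination τ * x.1 * hα'
  have h1 := hS.hasSum.prod_fiberwise fun J => (hS.prod_factor J).hasSum
  have hT : ∑' x, F x = thetaQuot m ν τ Z := by
    rw [hS.tsum_prod, ← Summable.tsum_comm (f := fun J l => F (J, l)) hS, thetaQuot,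
      theta_neg_one_eq, ← tsum_mul_left]
    refine tsum_congr fun l => ?_
    have h3 : ∑' J : ℤ, F (J, l) = qe (m * l * Z + τ * (m * l ^ 2) - (l + ν) / 2 +
        τ * (l ^ 2 / 2 + (ν + 1 / 2) * l + (m + 1 / 2) * α ^ 2)) * appell τ (ν + l) (Z / 2) := by
      rw [← (Equiv.subRight l).tsum_eq, appell, ← tsum_mul_left]
      refine tsum_congr fun k => ?_
      rw [hF, Equiv.subRight_apply]
      simp only [← mul_div_assoc, ← qe_add]
      rw [add_sub_cancel]
      congr 2
      push_cast
      linear_combination (-τ * (k - l)) * hα'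
    rw [h3, appell_eq hτ hZ, thetaRecip, neg_one_zpow_eq_qe, ← mul_assoc, ← qe_add,
      ← mul_assoc (qe (ν / 2)), ← qe_add, mul_right_comm _ (appell _ _ _), ← qe_add]
    congr 1
    refine qe_eq_of_sub_eq_intCast (-l - ν) ?_
    push_cast
    rw [← hα]
    linear_combination (-Z / 2 - τ * l) * hα'
  rw [hT] at h1
  refine h1.congr_fun fun J => ?_
  rw [appellShift, ← tsum_mul_left]

/-- The functions `G^{[m]}_{n,ν}` are the components of a quotient of theta functions. -/
theorem G_eq_sum_thetaQuot {m : ℕ} (hm : 0 < m) {n : ℕ} (hn : n < 2 * m) (ν : ℤ) {τ : ℂ}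
    (hτ : 0 < τ.im) {z : ℂ} (hz : OffLattice τ (m * z)) :
    G m n ν τ z = (1 / (2 * m : ℂ)) * ∑ b ∈ Finset.range (2 * m), qe (b * n / (2 * m)) *
      thetaQuot m ν τ (z - b / m) := by
  have hb : ∀ b : ℕ, OffLattice τ ((z - b / m) / 2) := hz.half_sub hm
  refine (G_hasSum hm n ν hτ hz).unique ?_
  have h := (hasSum_sum fun b (_ : b ∈ Finset.range (2 * m)) =>
    (hasSum_appellShift hm ν hτ (hb b)).mul_left (qe (b * n / (2 * m)))).mul_left (1 / (2 * m : ℂ))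
  refine h.congr_fun fun J => ?_
  rw [hNorm_eq_sum hm hn J hτ hz, mul_left_comm, Finset.mul_sum]
  congr 1
  refine Finset.sum_congr rfl fun b _ => ?_
  ring

/-! ### Inversion of the theta quotients. -/

/-- The multiplier relating `thetaQuot` at `-1 / τ` and at `τ`. -/
noncomputable def thetaMultiplier (m : ℕ) (τ : ℂ) : ℂ :=
  (-1) ^ m * τ * (-I * (-I * (τ / (2 * m + 1))) ^ (1 / 2 : ℂ))

lemma thetaQuot_neg_one_div (m : ℕ) {τ : ℂ} (hτ : 0 < τ.im) {Z : ℂ} (hZ : OffLattice τ (Z / 2)) :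
    thetaQuot m m (-1 / τ) (Z / τ) = thetaMultiplier m τ * qe (m * Z ^ 2 / (4 * τ)) *
      ∑ ν ∈ Finset.range (2 * m + 1), thetaQuot m ν τ Z := by
  have h0 := ne_zero_of_im_pos hτ
  have hm := two_mul_add_one_ne_zero m
  have hσ : 0 < (τ / (2 * m + 1)).im := by
    rw [show (2 * m + 1 : ℂ) = ((2 * m + 1 : ℕ) : ℂ) by push_cast; rfl, div_natCast_im]
    positivity
  have hS : ∑ ν ∈ Finset.range (2 * m + 1), thetaQuot m ν τ Z =
      thetaRecip τ (Z / 2) * oddTheta (τ / (2 * m + 1)) (Z / 2) := by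
    rw [← sum_theta_eq_oddTheta m hτ, Finset.mul_sum]
    refine Finset.sum_congr rfl fun ν _ => ?_
    rw [thetaQuot, zpow_natCast]
    ring
  rw [hS, thetaQuot, theta_middle_eq_oddTheta, show Z / τ / 2 = Z / 2 / τ by ring,
    thetaRecip_neg_one_div hτ hZ,
    show (2 * m + 1) * (-1 / τ) = -1 / (τ / (2 * m + 1)) by field_simp,
    show (m + 1 / 2) * (Z / τ) = Z / 2 / (τ / (2 * m + 1)) by field_simp,
    oddTheta_neg_one_div hσ, zpow_natCast, thetaMultiplier]
  have hq : qe (-((Z / 2) ^ 2 / (2 * τ))) * qe ((Z / 2) ^ 2 / (2 * (τ / (2 * m + 1)))) =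
      qe (m * Z ^ 2 / (4 * τ)) := by
    rw [← qe_add]
    congr 1
    field_simp
    ring
  rw [← hq]
  ring

lemma G_eq_add (m n : ℕ) (ν : ℤ) (τ z : ℂ) :
    G m n ν τ z = g m n ν τ * theta 1 ((n : ℤ) : ℝ) m τ z +
      (-1 : ℂ) ^ ν * theta (-1) ((ν : ℝ) + 1 / 2) (m + 1 / 2) τ 0 * hNorm m n ν τ z := by
  rw [G, ← qPow_mul_h]
  ring

lemma G_middle (m n : ℕ) (τ z : ℂ) :
    G m n m τ z = g m n m τ * theta 1 ((n : ℤ) : ℝ) m τ z := by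
  rw [G_eq_add, theta_middle_eq_oddTheta, mul_zero, oddTheta_zero]
  ring

lemma F_eq (m n : ℕ) (ν : ℤ) (τ z : ℂ) :
    F m (-(n : ℤ)) 0 n ν τ z =
      qe (-(n * z / 2) + τ * (n ^ 2 / (4 * m))) * G m n ν τ (z - n * τ / m) := by
  rw [F, qPow_eq_qe, qe_add]
  congr 2
  · rw [qe]; push_cast; ring_nf
  · push_cast; ring_nf
  · push_cast; ring_nf

/-- The transformation formula for the functions `F` before the limit `z → 0` is taken. -/
theorem multiplier_mul_sum_F {m : ℕ} (hm : 0 < m) {n : ℕ} (hn : n < 2 * m) {τ : ℂ} (hτ : 0 < τ.im)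
    {z : ℂ} (hz : OffLattice τ (m * z)) :
    thetaMultiplier m τ * ∑ k ∈ Finset.range (2 * m), qe (n * k / (2 * m)) *
        ∑ ν ∈ Finset.range (2 * m + 1), F m (-(k : ℤ)) 0 k ν τ z =
      g m n m (-1 / τ) * ∑ b ∈ Finset.range (2 * m), qe (-(m * (z - b / m) ^ 2 / (4 * τ))) *
        theta 1 ((n : ℤ) : ℝ) m (-1 / τ) ((z - b / m) / τ) := by
  have h0 := ne_zero_of_im_pos hτ
  have hm' : (m : ℂ) ≠ 0 := by exact_mod_cast hm.ne'
  -- Dividing z - kτ/m - b/m by τ gives (z - b/m)/τ - k/m: k now plays the role of the Fourier index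
  -- in G_{n,m} at -1/τ, so the sum over k reassembles that function.
  have hL : ∀ k ∈ Finset.range (2 * m), thetaMultiplier m τ * (qe (n * k / (2 * m)) *
      ∑ ν ∈ Finset.range (2 * m + 1), F m (-(k : ℤ)) 0 k ν τ z) =
      ∑ b ∈ Finset.range (2 * m), (1 / (2 * m : ℂ)) * qe (-(m * (z - b / m) ^ 2 / (4 * τ))) *
        (qe (k * n / (2 * m)) * thetaQuot m m (-1 / τ) ((z - b / m) / τ - k / m)) := by
    intro k hk
    have hzk : OffLattice τ (m * (z - k * τ / m)) := by
      convert hz.add 0 (-k) using 1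
      push_cast
      field_simp
      ring
    have h1 : ∀ ν : ℕ, F m (-(k : ℤ)) 0 k ν τ z =
        ∑ b ∈ Finset.range (2 * m), qe (-(k * z / 2) + τ * (k ^ 2 / (4 * m))) *
          ((1 / (2 * m : ℂ)) * (qe (b * k / (2 * m)) * thetaQuot m ν τ (z - k * τ / m - b / m))) := by
      intro ν
      rw [F_eq, G_eq_sum_thetaQuot hm (Finset.mem_range.1 hk) ν hτ hzk, Finset.mul_sum,
        Finset.mul_sum]
    simp only [h1]
    rw [Finset.sum_comm, Finset.mul_sum, Finset.mul_sum]
    refine Finset.sum_congr rfl fun b _ => ?_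
    rw [← Finset.mul_sum, ← Finset.mul_sum, ← Finset.mul_sum]
    have h2 := thetaQuot_neg_one_div m hτ (hzk.half_sub hm b)
    rw [show (z - b / m) / τ - k / m = (z - k * τ / m - b / m) / τ by field_simp; ring, h2]
    have hq : qe (-(k * z / 2) + τ * (k ^ 2 / (4 * m))) * qe (b * k / (2 * m)) =
        qe (-(m * (z - b / m) ^ 2 / (4 * τ))) * qe (m * (z - k * τ / m - b / m) ^ 2 / (4 * τ)) := by
      rw [← qe_add, ← qe_add]
      congr 1
      field_simp
      ring
    rw [mul_comm (n : ℂ) k]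
    linear_combination thetaMultiplier m τ * qe (k * n / (2 * m)) * (1 / (2 * m)) *
      (∑ ν ∈ Finset.range (2 * m + 1), thetaQuot m ν τ (z - k * τ / m - b / m)) * hq
  rw [Finset.mul_sum, Finset.sum_congr rfl hL, Finset.sum_comm, Finset.mul_sum]
  refine Finset.sum_congr rfl fun b _ => ?_
  have hzb : OffLattice (-1 / τ) (m * ((z - b / m) / τ)) := by
    have h1 : OffLattice τ (m * (z - b / m)) := by
      convert hz.add (-b) 0 using 1
      push_cast
      field_simp
      ring
    rw [← mul_div_assoc]
    exact h1.neg_one_div hτ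
  rw [← Finset.mul_sum, mul_left_comm, ← G_middle,
    G_eq_sum_thetaQuot hm hn m (im_neg_one_div_pos hτ) hzb]
  ring

/-- Completing the square, the b-th term is the residue class b modulo 2m of the Gaussian series
over N + n, where the shift by n is harmless; Poisson summation does the rest. -/
lemma sum_qe_mul_theta_zero {m : ℕ} (hm : 0 < m) (n : ℕ) {τ : ℂ} (hτ : 0 < τ.im) :
    ∑ b ∈ Finset.range (2 * m), qe (-(m * (0 - b / m) ^ 2 / (4 * τ))) *
      theta 1 ((n : ℤ) : ℝ) m (-1 / τ) ((0 - b / m) / τ) =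
    (-I * (2 * m * τ)) ^ (1 / 2 : ℂ) * jacobiTheta (2 * m * τ) := by
  have h0 := ne_zero_of_im_pos hτ
  have hm' : (m : ℂ) ≠ 0 := by exact_mod_cast hm.ne'
  have him : 0 < (2 * m * τ).im := by
    rw [show (2 * m : ℂ) = ((2 * m : ℝ) : ℂ) by push_cast; rfl, im_ofReal_mul]; positivity
  have him' : 0 < (-1 / (2 * m * τ) / 2).im := by
    have := im_neg_one_div_pos him
    simpa using this
  have hs := sqrt_neg_I_mul_ne_zero him
  have h1 := jacobiTheta₂_functional_equation 0 (2 * m * τ)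
  rw [jacobiTheta_eq_jacobiTheta₂, h1]
  have h2 : jacobiTheta₂ (0 / (2 * m * τ)) (-1 / (2 * m * τ)) =
      ∑' N : ℤ, qe (-1 / (2 * m * τ) / 2 * (N + n) ^ 2) := by
    rw [jacobiTheta₂_eq_tsum_qe, ← (Equiv.addRight (n : ℤ)).tsum_eq]
    refine tsum_congr fun N => ?_
    rw [Equiv.coe_addRight]
    push_cast
    ring_nf
  rw [h2, tsum_int_eq_sum_range (k := 2 * m) _ (by omega)]
  · rw [← mul_assoc, ← mul_assoc, mul_one_div_cancel hs]
    simp only [ne_eq, OfNat.ofNat_ne_zero, not_false_eq_true, zero_pow, mul_zero, zero_div,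
      Complex.exp_zero, mul_one, one_mul]
    refine Finset.sum_congr rfl fun b _ => ?_
    rw [theta_one_eq, ← tsum_mul_left]
    refine tsum_congr fun l => ?_
    rw [← qe_add]
    congr 1
    push_cast
    field_simp
    ring
  · refine (summable_qe_quadratic him' (2 * (-1 / (2 * m * τ) / 2) * n)
      (-1 / (2 * m * τ) / 2 * n ^ 2)).congr fun N => ?_
    ring_nf

lemma continuous_theta_one {m : ℕ} (hm : 0 < m) (s : ℝ) {τ : ℂ} (hτ : 0 < τ.im) :
    Continuous (theta 1 s m τ) := by
  have hm' : (m : ℂ) ≠ 0 := by exact_mod_cast hm.ne'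
  have him : 0 < (2 * m * τ).im := by
    rw [show (2 * m : ℂ) = ((2 * m : ℝ) : ℂ) by push_cast; rfl, im_ofReal_mul]; positivity
  have h : theta 1 s m τ = fun z => qe (s / 2 * z + τ * (s ^ 2 / (4 * m))) *
      jacobiTheta₂ (m * z + s * τ) (2 * m * τ) := by
    funext z
    rw [theta_one_eq, jacobiTheta₂_eq_tsum_qe, ← tsum_mul_left]
    refine tsum_congr fun j => ?_
    rw [← qe_add]
    congr 1
    push_cast
    field_simp
    ring
  have hJ : Continuous fun w => jacobiTheta₂ w (2 * m * τ) :=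
    continuous_iff_continuousAt.2 fun w => (differentiableAt_jacobiTheta₂_fst w him).continuousAt
  rw [h]
  exact (continuous_qe.comp (by fun_prop)).mul (hJ.comp (by fun_prop))

/-- A positive real factor leaves the principal root, so no branch sign appears. This is the source
of √(2m(2m+1)). -/
lemma sqrt_ratio {m : ℕ} (hm : 0 < m) {τ : ℂ} (hτ : 0 < τ.im) :
    (-I * (2 * m * τ)) ^ (1 / 2 : ℂ) =
      (Real.sqrt (2 * m * (2 * m + 1)) : ℂ) * (-I * (τ / (2 * m + 1))) ^ (1 / 2 : ℂ) := by
  have h0 := ne_zero_of_im_pos hτ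
  have h1 := two_mul_add_one_ne_zero m
  set x : ℂ := -I * (τ / (2 * m + 1)) with hx
  have hx0 : x ≠ 0 := mul_ne_zero (neg_ne_zero.2 I_ne_zero) (div_ne_zero h0 h1)
  have hr : (0 : ℝ) < 2 * m * (2 * m + 1) := by positivity
  have he : -I * (2 * m * τ) = ((2 * m * (2 * m + 1) : ℝ) : ℂ) * x := by
    rw [hx]; push_cast; field_simp
  have hr0 : ((2 * m * (2 * m + 1) : ℝ) : ℂ) ≠ 0 := by exact_mod_cast hr.ne'
  rw [he, Complex.cpow_def_of_ne_zero (mul_ne_zero hr0 hx0), Complex.cpow_def_of_ne_zero hx0,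
    Complex.log_ofReal_mul hr hx0, add_mul, Complex.exp_add, Real.sqrt_eq_rpow,
    Complex.ofReal_cpow hr.le, Complex.cpow_def_of_ne_zero hr0, Complex.ofReal_log hr.le]
  push_cast
  rfl

/-! ### Values and poles at z = 0, and the sums D. -/

/-- The series `h^{[m]}_{n,J}`, normalized, as a function of `v = m z` and with the term that has
a pole at `v = 0` removed when `n = 0`. -/
noncomputable def hReg (m n : ℕ) (J : ℤ) (τ v : ℂ) : ℂ :=
  ∑' l : ℤ, if n = 0 → l + J ≠ 0 then
    qe (l * v + τ * (m * l ^ 2 + n * l)) / (1 - qe (v + ((2 * m * (l + J) : ℤ) : ℂ) * τ)) else 0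

lemma two_mul_mul_sub_ne_zero {m n : ℕ} (hm : 0 < m) (hn : n < 2 * m) {J : ℤ}
    (hJ : n = 0 → J ≠ 0) : 2 * m * J - n ≠ 0 := by
  intro e
  have h1 : (2 * m : ℤ) ∣ n := ⟨J, by linarith⟩
  have h2 : (n : ℤ) = 0 := Int.eq_zero_of_dvd_of_nonneg_of_lt (by positivity) (by omega) h1
  have h3 : n = 0 := by exact_mod_cast h2
  rw [h3] at e
  have : (m : ℤ) ≠ 0 := by exact_mod_cast hm.ne'
  have h4 := hJ h3
  simp_all

/-- The base point is m(z - nτ/m) at z = 0. There the denominators are 1 - q^{2m(l+J)-n}, which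
vanish only for n = 0 and l + J = 0, the omitted term. -/
lemma differentiableAt_hReg {m n : ℕ} (hm : 0 < m) (hn : n < 2 * m) (J : ℤ) {τ : ℂ}
    (hτ : 0 < τ.im) : DifferentiableAt ℂ (hReg m n J τ) (-(n * τ)) := by
  classical
  have him : 0 < (2 * m * τ).im := by
    rw [show (2 * m : ℂ) = ((2 * m : ℝ) : ℂ) by push_cast; rfl, im_ofReal_mul]; positivity
  have hsum := summable_pow_mul_jacobiTheta₂_term_bound 1 him 0
  simp only [pow_zero, one_mul] at hsum
  have hS : ∀ l ∈ {l : ℤ | n = 0 → l + J ≠ 0},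
      qe (-(n * τ) + ((2 * m * (l + J) : ℤ) : ℂ) * τ) ≠ 1 := fun l hl => by
    have := int_mul_qe_ne_one hτ (two_mul_mul_sub_ne_zero hm hn hl)
    convert this using 2
    push_cast
    ring
  have h := differentiableAt_tsum_div_one_sub hτ (-(n * τ)) {l : ℤ | n = 0 → l + J ≠ 0}
    (fun l => 2 * m * (l + J)) hS (fun l v => qe (l * v + τ * (m * l ^ 2 + n * l)))
    (fun l => differentiable_qe.comp (by fun_prop)) _ hsum ?_
  · convert h using 1
    funext v
    refine tsum_congr fun l => if_congr Iff.rfl rfl rfl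
  · have hc : ContinuousAt (fun v : ℂ => |(v + n * τ).im|) (-(n * τ)) := by fun_prop
    filter_upwards [hc.eventually (gt_mem_nhds (by simp : |(-(n * τ) + n * τ).im| < 1))] with v hv l
    refine le_of_eq_of_le ?_ (norm_jacobiTheta₂_term_le him hv.le le_rfl l)
    rw [jacobiTheta₂_term_eq_qe]
    congr 2
    ring

lemma hNorm_eq_hReg {m n : ℕ} (hn : n ≠ 0) (J : ℤ) (τ z : ℂ) :
    hNorm m n J τ z = qe (n * z / 2 + τ * (n * J - m * J ^ 2)) * hReg m n J τ (m * z) := by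
  rw [hNorm, hReg, ← tsum_mul_left]
  refine tsum_congr fun l => ?_
  rw [if_pos (fun h => absurd h hn), ← mul_div_assoc, ← qe_add]
  congr 2
  ring

lemma hNorm_zero_eq_hReg {m : ℕ} (hm : 0 < m) (J : ℤ) {τ : ℂ} (hτ : 0 < τ.im) {z : ℂ}
    (hz : OffLattice τ (m * z)) :
    hNorm m 0 J τ z = qe (-(τ * (m * J ^ 2))) * hReg m 0 J τ (m * z) +
      qe (-(J * (m * z))) / (1 - qe (m * z)) := by
  rw [hNorm, (summable_hNorm hm 0 J hτ hz).tsum_eq_add_tsum_ite (-J), hReg, ← tsum_mul_left, add_comm]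
  congr 1
  · refine tsum_congr fun l => ?_
    by_cases hl : l = -J
    · simp [hl]
    · have : l + J ≠ 0 := fun h => hl (by omega)
      rw [if_neg hl, if_pos (fun _ => this), ← mul_div_assoc, ← qe_add]
      congr 2
      push_cast
      ring
  · congr 2
    · push_cast; ring
    · push_cast; ring_nf

lemma hasSum_int_of_nat {f : ℤ → ℂ} {a : ℂ} (hf : ∀ k < 0, f k = 0)
    (h : HasSum (fun i : ℕ => f i) a) : HasSum f a := by
  refine (Function.Injective.hasSum_iff Nat.cast_injective fun k hk => hf k ?_).1 h
  by_contra! h0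
  exact hk ⟨k.toNat, Int.toNat_of_nonneg h0⟩

lemma hasSum_geometric_nonneg {v : ℂ} (hv : 0 < v.im) :
    HasSum (fun k : ℤ => if 0 ≤ k then qe (k * v) else 0) (1 / (1 - qe v)) := by
  refine hasSum_int_of_nat (fun k hk => if_neg (not_le.2 hk)) ?_
  rw [one_div]
  refine (hasSum_geometric_of_norm_lt_one (norm_qe_lt_one hv)).congr_fun fun i => ?_
  rw [if_pos (by positivity), ← qe_natCast_mul]
  simp

lemma hasSum_geometric_neg {v : ℂ} (hv : v.im < 0) :
    HasSum (fun k : ℤ => if k < 0 then -qe (k * v) else 0) (1 / (1 - qe v)) := by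
  have h1 : 0 < (-v).im := by simpa using hv
  rw [← (Equiv.subLeft (-1 : ℤ)).hasSum_iff]
  have h2 := (hasSum_geometric_nonneg h1).mul_left (-qe (-v))
  have h3 : -qe (-v) * (1 / (1 - qe (-v))) = 1 / (1 - qe v) := by
    have h4 : 1 - qe (-v) ≠ 0 := by
      rw [sub_ne_zero]
      intro e
      have := norm_qe_lt_one h1
      rw [← e] at this
      simp at this
    have h5 : 1 - qe v = -qe v * (1 - qe (-v)) := by
      rw [mul_one_sub, neg_mul, ← qe_add]; simp; ring
    rw [h5, qe_neg] at *
    have := qe_ne_zero v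
    field_simp
  rw [← h3]
  refine h2.congr_fun fun k => ?_
  rw [Function.comp_apply, Equiv.subLeft_apply]
  by_cases hk : 0 ≤ k
  · rw [if_pos hk, if_pos (by omega), neg_mul, ← qe_add]
    push_cast
    ring_nf
  · rw [if_neg hk, if_neg (by omega), mul_zero]

/-- The indefinite double sum `D^{[m]}_{n,ν}` is a value of the regularized `h^{[m]}_{n,ν}`. -/
theorem D_eq_hReg {m n : ℕ} (hm : 0 < m) (hn : n < 2 * m) {ν : ℤ} (hν : 0 ≤ ν) {τ : ℂ}
    (hτ : 0 < τ.im) :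
    D m n ν τ = qe (-(τ * (m * (ν - n / (2 * m)) ^ 2))) * hReg m n ν τ (-(n * τ)) +
      if n = 0 then (ν : ℂ) else 0 := by
  classical
  have hm' : (m : ℂ) ≠ 0 := by exact_mod_cast hm.ne'
  have hmr : (0 : ℝ) < m := by exact_mod_cast hm
  have hn2 : (((n : ℕ) : ℤ) : ℝ) < 2 * m := by exact_mod_cast hn
  have hP := summable_dTerm_dPos hτ hmr (Nat.cast_nonneg n) hn2 hν
  have hN := summable_dTerm_dNeg hτ hmr (Nat.cast_nonneg n) hn2 hν
  set d : ℤ × ℤ → ℂ := dTerm m n ν τ with hd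
  rw [← Function.comp_def d, summable_subtype_iff_indicator] at hP hN
  have hD : D m n ν τ = (∑' x, dPos.indicator d x - ∑' x, (dNeg n).indicator d x) +
      if n = 0 then (ν : ℂ) else 0 := by
    rw [D, tsum_subtype dPos d, tsum_subtype (dNeg n) d]
    simp
  rw [hD]
  congr 1
  -- With J = j - k the exponent is linear in k. The cones give geometric series in q^{2mJ-n}, over
  -- k ≥ 0 for J > 0 and over k < 0 for J ≤ 0, each in its region of convergence.
  let e : ℤ × ℤ ≃ ℤ × ℤ :=
    { toFun := fun x => (x.1 + x.2, x.2)
      invFun := fun x => (x.1 - x.2, x.2)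
      left_inv := fun x => by simp
      right_inv := fun x => by simp }
  have hS := e.hasSum_iff.2 (hP.hasSum.sub hN.hasSum)
  set A : ℤ → ℂ := fun J => qe (-(τ * (m * (ν - n / (2 * m)) ^ 2)) + τ * (m * (J - ν) ^ 2)) with hA
  have hterm : ∀ J k : ℤ, d (J + k, k) = A J * qe (k * (((2 * m * J - n : ℤ) : ℂ) * τ)) := by
    intro J k
    rw [hd, dTerm, qPow_eq_qe, hA, ← qe_add]
    congr 1
    push_cast
    field_simp
    ring
  have hfib : ∀ J : ℤ, HasSum (fun k : ℤ => dPos.indicator d (e (J, k)) - (dNeg n).indicator d (e (J, k)))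
      (if n = 0 → J ≠ 0 then A J * (1 / (1 - qe (((2 * m * J - n : ℤ) : ℂ) * τ))) else 0) := by
    intro J
    have hpos : ∀ k : ℤ, dPos.indicator d (e (J, k)) =
        if 0 < J ∧ 0 ≤ k then A J * qe (k * (((2 * m * J - n : ℤ) : ℂ) * τ)) else 0 := by
      intro k
      rw [Set.indicator_apply, ← hterm]
      refine if_congr ?_ rfl rfl
      change k < J + k ∧ 0 ≤ k ↔ _
      omega
    have hneg : ∀ k : ℤ, (dNeg n).indicator d (e (J, k)) =
        if J ≤ 0 ∧ k < 0 ∧ (n = 0 → J ≠ 0) then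
          A J * qe (k * (((2 * m * J - n : ℤ) : ℂ) * τ)) else 0 := by
      intro k
      rw [Set.indicator_apply, ← hterm]
      refine if_congr ?_ rfl rfl
      change J + k ≤ k ∧ k < 0 ∧ ((n : ℤ) = 0 → J + k ≠ k) ↔ _
      omega
    simp only [hpos, hneg]
    have him : (((2 * m * J - n : ℤ) : ℂ) * τ).im = (2 * m * J - n : ℤ) * τ.im := by
      rw [← ofReal_intCast, im_ofReal_mul]
    by_cases hJ : n = 0 → J ≠ 0
    · rw [if_pos hJ]
      rcases lt_or_ge 0 J with hJ0 | hJ0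
      · have h1 : 0 < (((2 * m * J - n : ℤ) : ℂ) * τ).im := by
          rw [him]
          have : 0 < 2 * (m : ℤ) * J - n := by nlinarith
          have : (0 : ℝ) < (2 * (m : ℤ) * J - n : ℤ) := by exact_mod_cast this
          positivity
        refine ((hasSum_geometric_nonneg h1).mul_left (A J)).congr_fun fun k => ?_
        simp only [hJ0, not_le.2 hJ0, true_and, false_and, if_false, sub_zero]
        split_ifs <;> simp
      · have h1 : (((2 * m * J - n : ℤ) : ℂ) * τ).im < 0 := by
          rw [him]
          have h2 : 2 * (m : ℤ) * J - n ≤ 0 := by nlinarith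
          have h3 : 2 * (m : ℤ) * J - n < 0 :=
            lt_of_le_of_ne h2 (two_mul_mul_sub_ne_zero hm hn hJ)
          have : ((2 * (m : ℤ) * J - n : ℤ) : ℝ) < 0 := by exact_mod_cast h3
          exact mul_neg_of_neg_of_pos this hτ
        refine ((hasSum_geometric_neg h1).mul_left (A J)).congr_fun fun k => ?_
        simp only [hJ0, not_lt.2 hJ0, true_and, false_and, if_false, zero_sub]
        by_cases hk : k < 0
        · rw [if_pos ⟨hk, hJ⟩, if_pos hk, mul_neg]
        · rw [if_neg (fun h => hk h.1), if_neg hk]; simp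
    · rw [if_neg hJ]
      have hJ0 : J = 0 := by
        by_contra h; exact hJ fun _ => h
      refine hasSum_zero.congr_fun fun k => ?_
      rw [if_neg (by omega), if_neg (fun h => hJ h.2.2), sub_zero]
  have hfin := (hS.prod_fiberwise hfib).tsum_eq
  rw [← hfin, hReg, ← tsum_mul_left, ← (Equiv.addRight ν).tsum_eq]
  refine tsum_congr fun l => ?_
  rw [Equiv.coe_addRight]
  by_cases hl : n = 0 → l + ν ≠ 0
  · rw [if_pos hl, if_pos hl, mul_one_div, ← mul_div_assoc, ← qe_add]
    simp only [hA]
    congr 2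
    · push_cast; ring
    · congr 1; push_cast; ring
  · rw [if_neg hl, if_neg hl, mul_zero]

/-- The value at `z = 0` of `F^{[m](-n,0)}_{n,ν}`, up to the polar part when `n = 0`. -/
noncomputable def regValue (m n : ℕ) (ν : ℤ) (τ : ℂ) : ℂ :=
  g m n ν τ * jacobiTheta (2 * m * τ) +
    (-1 : ℂ) ^ ν * theta (-1) ((ν : ℝ) + 1 / 2) (m + 1 / 2) τ 0 * D m n ν τ

/-- The shift by -nτ/m moves the centre n/(2m) back to 0, so one theta constant serves every n. -/
lemma qe_mul_theta_shift {m : ℕ} (hm : 0 < m) (n : ℕ) (τ : ℂ) :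
    qe (τ * (n ^ 2 / (4 * m))) * theta 1 ((n : ℤ) : ℝ) m τ (-(n * τ / m)) =
      jacobiTheta (2 * m * τ) := by
  have hm' : (m : ℂ) ≠ 0 := by exact_mod_cast hm.ne'
  rw [theta_one_eq, jacobiTheta_eq_jacobiTheta₂, jacobiTheta₂_eq_tsum_qe, ← tsum_mul_left]
  refine tsum_congr fun j => ?_
  rw [← qe_add]
  congr 1
  push_cast
  field_simp
  ring

lemma tendsto_F {m n : ℕ} (hm : 0 < m) (hn0 : n ≠ 0) (hn : n < 2 * m) (ν : ℕ) {τ : ℂ}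
    (hτ : 0 < τ.im) :
    F m (-(n : ℤ)) 0 n ν τ 0 = regValue m n ν τ ∧
      Tendsto (F m (-(n : ℤ)) 0 n ν τ) (𝓝[≠] 0) (𝓝 (F m (-(n : ℤ)) 0 n ν τ 0)) := by
  have hm' : (m : ℂ) ≠ 0 := by exact_mod_cast hm.ne'
  have hmz : ∀ z : ℂ, m * (z - n * τ / m) = m * z - n * τ := fun z => by field_simp
  have hF : F m (-(n : ℤ)) 0 n ν τ = fun z => qe (-(n * z / 2) + τ * (n ^ 2 / (4 * m))) *
      (g m n ν τ * theta 1 ((n : ℤ) : ℝ) m τ (z - n * τ / m) +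
      (-1 : ℂ) ^ (ν : ℤ) * theta (-1) (((ν : ℤ) : ℝ) + 1 / 2) (m + 1 / 2) τ 0 *
      (qe (n * (z - n * τ / m) / 2 + τ * (n * ν - m * ν ^ 2)) *
        hReg m n ν τ (m * z - n * τ))) := by
    funext z
    rw [F_eq, G_eq_add, hNorm_eq_hReg hn0, hmz]
    simp
  refine ⟨?_, ?_⟩
  · rw [hF]
    simp only [mul_zero, zero_div, neg_zero, zero_add, zero_sub]
    rw [regValue, D_eq_hReg hm hn (Int.natCast_nonneg ν) hτ, if_neg hn0, ← qe_mul_theta_shift hm n,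
      add_zero]
    have hq : qe (-(τ * (m * (((ν : ℤ) : ℂ) - n / (2 * m)) ^ 2))) = qe (τ * (n ^ 2 / (4 * m))) *
        qe (n * -(n * τ / m) / 2 + τ * (n * ν - m * ν ^ 2)) := by
      rw [← qe_add]
      congr 1
      push_cast
      field_simp
      ring
    rw [hq]
    ring
  · have hc : ContinuousAt (F m (-(n : ℤ)) 0 n ν τ) 0 := by
      rw [hF]
      have hR : ContinuousAt (fun z : ℂ => hReg m n ν τ (m * z - n * τ)) 0 :=
        ContinuousAt.comp_of_eq (differentiableAt_hReg hm hn ν hτ).continuousAt (by fun_prop)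
          (by simp)
      have hθ : Continuous fun z => theta 1 ((n : ℤ) : ℝ) m τ (z - n * τ / m) :=
        (continuous_theta_one hm _ hτ).comp (by fun_prop)
      exact (continuous_qe.comp (by fun_prop)).continuousAt.mul
        ((hθ.continuousAt.const_mul _).add
          (((continuous_qe.comp (by fun_prop)).continuousAt.mul hR).const_mul _))
    exact hc.tendsto.mono_left nhdsWithin_le_nhds

lemma eventually_offLattice_natCast_mul {m : ℕ} (hm : 0 < m) {τ : ℂ} (hτ : 0 < τ.im) :
    ∀ᶠ z in 𝓝[≠] (0 : ℂ), OffLattice τ (m * z) := by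
  have hm' : (m : ℂ) ≠ 0 := by exact_mod_cast hm.ne'
  have h : Tendsto (fun z : ℂ => m * z) (𝓝[≠] 0) (𝓝[≠] 0) := by
    refine tendsto_nhdsWithin_iff.2 ⟨?_, ?_⟩
    · have : ContinuousAt (fun z : ℂ => m * z) 0 := by fun_prop
      simpa [ContinuousAt] using this.mono_left (nhdsWithin_le_nhds (s := {0}ᶜ))
    · filter_upwards [self_mem_nhdsWithin] with z hz
      exact mul_ne_zero hm' hz
  exact h.eventually (eventually_offLattice hτ)

/-- A finite geometric sum of ν terms, each tending to 1 as v → 0: the origin of the summand ν in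
D_{0,ν}. -/
lemma qe_neg_mul_sub_one_div {v : ℂ} (hv : qe v ≠ 1) (ν : ℕ) :
    (qe (-(ν * v)) - 1) / (1 - qe v) = ∑ s ∈ Finset.range ν, qe (-((s + 1) * v)) := by
  rw [div_eq_iff (sub_ne_zero.2 hv.symm)]
  induction ν with
  | zero => simp
  | succ ν ih =>
    rw [Finset.sum_range_succ, add_mul, ← ih, mul_one_sub, ← qe_add]
    push_cast
    ring_nf

/-- The poles of the functions `F^{[m](0,0)}_{0,ν}` at `z = 0` cancel in the sum over `ν`. -/
lemma tendsto_sum_F_zero {m : ℕ} (hm : 0 < m) {τ : ℂ} (hτ : 0 < τ.im) :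
    Tendsto (fun z => ∑ ν ∈ Finset.range (2 * m + 1), F m 0 0 0 ν τ z) (𝓝[≠] 0)
      (𝓝 (∑ ν ∈ Finset.range (2 * m + 1), regValue m 0 ν τ)) := by
  set t : ℕ → ℂ := fun ν => (-1 : ℂ) ^ (ν : ℤ) *
    theta (-1) (((ν : ℤ) : ℝ) + 1 / 2) (m + 1 / 2) τ 0 with ht
  -- The polar part of the ν-th term is t ν/(1 - qe (m z)), and the t ν add up to an odd theta
  -- function at 0.
  have ht0 : ∑ ν ∈ Finset.range (2 * m + 1), t ν = 0 := by
    have := sum_theta_eq_oddTheta m hτ 0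
    rw [zero_div, oddTheta_zero] at this
    simpa only [ht, zpow_natCast] using this
  set R : ℂ → ℂ := fun z => ∑ ν ∈ Finset.range (2 * m + 1),
    (g m (0 : ℕ) ν τ * theta 1 (((0 : ℕ) : ℤ) : ℝ) m τ z + t ν *
      (qe (-(τ * (m * (ν : ℤ) ^ 2))) * hReg m 0 ν τ (m * z) +
        ∑ s ∈ Finset.range ν, qe (-((s + 1) * (m * z))))) with hR
  have hRc : ContinuousAt R 0 := by
    refine tendsto_finsetSum _ fun ν _ => ?_
    have h1 : ContinuousAt (fun z : ℂ => hReg m 0 ν τ (m * z)) 0 :=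
      ContinuousAt.comp_of_eq (differentiableAt_hReg hm (by omega) ν hτ).continuousAt
        (by fun_prop) (by simp)
    have h2 : ContinuousAt (fun z : ℂ => ∑ s ∈ Finset.range ν, qe (-((s + 1) * (m * z)))) 0 := by
      fun_prop
    exact ((continuous_theta_one hm _ hτ).continuousAt.const_mul _).add
      (((h1.const_mul _).add h2).const_mul _)
  have hR0 : R 0 = ∑ ν ∈ Finset.range (2 * m + 1), regValue m 0 ν τ := by
    refine Finset.sum_congr rfl fun ν _ => ?_
    rw [regValue, D_eq_hReg hm (by omega) (Int.natCast_nonneg ν) hτ, if_pos rfl,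
      ← qe_mul_theta_shift hm 0]
    simp [ht]
  rw [← hR0]
  refine (hRc.tendsto.mono_left nhdsWithin_le_nhds).congr' ?_
  filter_upwards [eventually_offLattice_natCast_mul hm hτ] with z hz
  have hq : qe (m * z) ≠ 1 := by simpa using hz.qe_ne_one 0
  have h1 : ∀ ν : ℕ, F m 0 0 0 ν τ z = g m (0 : ℕ) ν τ * theta 1 (((0 : ℕ) : ℤ) : ℝ) m τ z + t ν *
      (qe (-(τ * (m * (ν : ℤ) ^ 2))) * hReg m 0 ν τ (m * z) +
        ∑ s ∈ Finset.range ν, qe (-((s + 1) * (m * z)))) + 1 / (1 - qe (m * z)) * t ν := by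
    intro ν
    have h2 := F_eq m 0 ν τ z
    rw [G_eq_add] at h2
    simp only [Nat.cast_zero, neg_zero, zero_mul, zero_div, sub_zero, ne_eq, OfNat.ofNat_ne_zero,
      not_false_eq_true, zero_pow, mul_zero, add_zero, qe_zero, one_mul] at h2
    rw [h2, hNorm_zero_eq_hReg hm ν hτ hz, ← qe_neg_mul_sub_one_div hq]
    simp only [Nat.cast_zero, ht]
    push_cast
    ring
  rw [Finset.sum_congr rfl fun ν _ => h1 ν, Finset.sum_add_distrib, ← Finset.mul_sum, ht0, mul_zero,
    add_zero]

/-! ### The limit z → 0 and the final formulas. -/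

lemma theta_zero_eq_vartheta01 (m ν : ℕ) (τ : ℂ) :
    theta (-1) (((ν : ℤ) : ℝ) + 1 / 2) (m + 1 / 2) τ 0 =
      qPow τ (1 / (4 * ((m : ℝ) + 1 / 2)) * ((ν : ℝ) + 1 / 2) ^ 2) *
        vartheta01 (2 * ((m : ℂ) + 1 / 2) * τ) (((ν : ℂ) + 1 / 2) * τ) := by
  have h2 := two_mul_add_one_ne_zero m
  rw [theta_neg_one_eq, vartheta01, jacobiTheta₂_eq_tsum_qe, ← tsum_mul_left]
  refine tsum_congr fun j => ?_
  rw [qPow_eq_qe, ← qe_add]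
  congr 1
  push_cast
  rw [show (m + 1 / 2 : ℂ) = (2 * m + 1) / 2 by ring]
  field_simp
  ring

/-- The first expression for `g^{[m]}_{n,m}(-1 / τ)`, with the eta quotient as a theta constant. -/
theorem multiplier_mul_sum_F_zero {m : ℕ} (hm : 0 < m) {n : ℕ} (hn : n < 2 * m) {τ : ℂ}
    (hτ : 0 < τ.im) :
    thetaMultiplier m τ * (∑ ν ∈ Finset.range (2 * m + 1), regValue m 0 ν τ +
        ∑ k ∈ Finset.Ico 1 (2 * m), qe (n * k / (2 * m)) *
          ∑ ν ∈ Finset.range (2 * m + 1), F m (-(k : ℤ)) 0 k ν τ 0) =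
      g m n m (-1 / τ) * ((-I * (2 * m * τ)) ^ (1 / 2 : ℂ) * jacobiTheta (2 * m * τ)) := by
  have hL : Tendsto (fun z => thetaMultiplier m τ * ∑ k ∈ Finset.range (2 * m),
      qe (n * k / (2 * m)) * ∑ ν ∈ Finset.range (2 * m + 1), F m (-(k : ℤ)) 0 k ν τ z) (𝓝[≠] 0)
      (𝓝 (thetaMultiplier m τ * (∑ ν ∈ Finset.range (2 * m + 1), regValue m 0 ν τ +
        ∑ k ∈ Finset.Ico 1 (2 * m), qe (n * k / (2 * m)) *
          ∑ ν ∈ Finset.range (2 * m + 1), F m (-(k : ℤ)) 0 k ν τ 0))) := by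
    refine Tendsto.const_mul _ ?_
    simp only [Finset.range_eq_Ico, Finset.sum_eq_sum_Ico_succ_bot (show 0 < 2 * m by omega)]
    rw [← Finset.range_eq_Ico]
    refine Tendsto.add ?_ (tendsto_finsetSum _ fun k hk => Tendsto.const_mul _
      (tendsto_finsetSum _ fun ν _ => ?_))
    · simpa using tendsto_sum_F_zero hm hτ
    · rw [zero_add, Finset.mem_Ico] at hk
      exact (tendsto_F hm (by omega) hk.2 ν hτ).2
  have hR : Tendsto (fun z => g m n m (-1 / τ) * ∑ b ∈ Finset.range (2 * m),
      qe (-(m * (z - b / m) ^ 2 / (4 * τ))) *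
        theta 1 ((n : ℤ) : ℝ) m (-1 / τ) ((z - b / m) / τ)) (𝓝[≠] 0)
      (𝓝 (g m n m (-1 / τ) * ((-I * (2 * m * τ)) ^ (1 / 2 : ℂ) * jacobiTheta (2 * m * τ)))) := by
    rw [← sum_qe_mul_theta_zero hm n hτ]
    have hc : Continuous (fun z : ℂ => g m n m (-1 / τ) * ∑ b ∈ Finset.range (2 * m),
        qe (-(m * (z - b / m) ^ 2 / (4 * τ))) *
          theta 1 ((n : ℤ) : ℝ) m (-1 / τ) ((z - b / m) / τ)) := by
      refine continuous_const.mul (continuous_finsetSum _ fun b _ => ?_)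
      exact (continuous_qe.comp (by fun_prop)).mul
        ((continuous_theta_one hm _ (im_neg_one_div_pos hτ)).comp (by fun_prop))
    exact (hc.tendsto 0).mono_left nhdsWithin_le_nhds
  -- The identity holds only off the poles, so it is carried to z = 0 through punctured limits.
  refine tendsto_nhds_unique hL (hR.congr' ?_)
  filter_upwards [eventually_offLattice_natCast_mul hm hτ] with z hz
  exact (multiplier_mul_sum_F hm hn hτ hz).symm

lemma eta_quotient_mul_jacobiTheta {m : ℕ} (hm : 0 < m) {τ : ℂ} (hτ : 0 < τ.im) :
    ModularForm.eta (m * τ) ^ 2 * ModularForm.eta (4 * m * τ) ^ 2 /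
      ModularForm.eta (2 * m * τ) ^ 5 * jacobiTheta (2 * m * τ) = 1 := by
  have hT : 0 < ((m : ℂ) * τ).im := by
    rw [← ofReal_natCast, im_ofReal_mul]; positivity
  have h2 : 0 < (2 * ((m : ℂ) * τ)).im := by simpa using hT
  have h4 : 0 < (4 * ((m : ℂ) * τ)).im := by simpa using hT
  have e1 := ModularForm.eta_ne_zero hT
  have e2 := ModularForm.eta_ne_zero h2
  have e4 := ModularForm.eta_ne_zero h4
  rw [mul_assoc 2, mul_assoc 4, jacobiTheta_eq_eta_quotient hT, div_mul_div_comm, mul_comm,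
    div_self (by positivity)]

/-- The sum over `n` and `ν` of the values at `z = 0`, expanded in the series `g` and `D`. -/
lemma eta_quotient_mul_sum_regValue {m : ℕ} (n : ℕ) {τ E : ℂ}
    (hE : E * jacobiTheta (2 * m * τ) = 1) :
    (-1 : ℂ) ^ m * (E * ∑ k ∈ Finset.range (2 * m), ∑ ν ∈ Finset.range (2 * m + 1),
        cexp ((Real.pi : ℂ) * I * n * k / m) * regValue m k ν τ) =
      (-1 : ℂ) ^ m * (∑ k ∈ Finset.range (2 * m), ∑ ν ∈ Finset.range (2 * m + 1),
          cexp ((Real.pi : ℂ) * I * n * k / m) * g m k ν τ) +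
        E * (∑ k ∈ Finset.range (2 * m), ∑ ν ∈ Finset.range (2 * m + 1),
          (-1 : ℂ) ^ (m + ν) * cexp ((Real.pi : ℂ) * I * n * k / m) *
            qPow τ (1 / (4 * ((m : ℝ) + 1 / 2)) * ((ν : ℝ) + 1 / 2) ^ 2) *
            vartheta01 (2 * ((m : ℂ) + 1 / 2) * τ) (((ν : ℂ) + 1 / 2) * τ) * D m k ν τ) := by
  simp only [Finset.mul_sum, ← Finset.sum_add_distrib]
  refine Finset.sum_congr rfl fun k _ => Finset.sum_congr rfl fun ν _ => ?_
  rw [regValue, theta_zero_eq_vartheta01, zpow_natCast, pow_add]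
  linear_combination (-1 : ℂ) ^ m * cexp ((Real.pi : ℂ) * I * n * k / m) * g m k ν τ * hE

/-- `g^{[m]}_{n,m}(-1 / τ)` as a multiple of the sum of the values at `z = 0`. -/
lemma g_neg_one_div {m : ℕ} (hm : 0 < m) {n : ℕ} (hn : n < 2 * m) {τ E : ℂ} (hτ : 0 < τ.im)
    (hE : E * jacobiTheta (2 * m * τ) = 1) :
    g m n m (-1 / τ) = -(I * τ / (Real.sqrt (2 * m * (2 * m + 1)) : ℂ)) *
      ((-1 : ℂ) ^ m * (E * (∑ ν ∈ Finset.range (2 * m + 1), regValue m 0 ν τ +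
        ∑ k ∈ Finset.Ico 1 (2 * m), ∑ ν ∈ Finset.range (2 * m + 1),
          cexp ((Real.pi : ℂ) * I * n * k / m) * F m (-(k : ℤ)) 0 k ν τ 0))) := by
  have hm0 : (m : ℂ) ≠ 0 := by exact_mod_cast hm.ne'
  have h := multiplier_mul_sum_F_zero hm hn hτ
  have hexp : ∀ k : ℕ, qe (n * k / (2 * m)) = cexp ((Real.pi : ℂ) * I * n * k / m) := fun k => by
    rw [qe]; congr 1; field_simp
  simp only [hexp, Finset.mul_sum (Finset.range (2 * m + 1))] at h
  have him : 0 < (τ / (2 * m + 1)).im := by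
    rw [show (2 * m + 1 : ℂ) = ((2 * m + 1 : ℕ) : ℂ) by push_cast; ring, div_natCast_im]
    positivity
  have hx := sqrt_neg_I_mul_ne_zero him
  have hs : (Real.sqrt (2 * m * (2 * m + 1)) : ℂ) ≠ 0 := by
    rw [ofReal_ne_zero, Real.sqrt_ne_zero']; positivity
  rw [thetaMultiplier, sqrt_ratio hm hτ] at h
  generalize (∑ ν ∈ Finset.range (2 * m + 1), regValue m 0 ν τ +
    ∑ k ∈ Finset.Ico 1 (2 * m), ∑ ν ∈ Finset.range (2 * m + 1),
      cexp ((Real.pi : ℂ) * I * n * k / m) * F m (-(k : ℤ)) 0 k ν τ 0) = S at h ⊢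
  generalize (-I * (τ / (2 * m + 1))) ^ (1 / 2 : ℂ) = x at h hx
  generalize g m n m (-1 / τ) = y at h ⊢
  field_simp
  refine mul_right_cancel₀ hx ?_
  linear_combination (-E) * h - y * (Real.sqrt (2 * m * (2 * m + 1)) : ℂ) * x * hE

end IndefiniteModular

theorem mainTheorem3 (m : ℕ) (hm : 0 < m) (n : ℕ) (hn : n < 2 * m) (τ : ℂ) (hτ : 0 < τ.im) :
    -- all the double series below converge absolutely
    (∀ n' ∈ Finset.range (2 * m), ∀ ν' ∈ Finset.range (2 * m + 1),
      Summable (fun x : IndefiniteModular.gPos => IndefiniteModular.gTerm m n' ν' τ x) ∧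
      Summable (fun x : IndefiniteModular.gNeg => IndefiniteModular.gTerm m n' ν' τ x) ∧
      Summable (fun x : IndefiniteModular.dPos => IndefiniteModular.dTerm m n' ν' τ x) ∧
      Summable (fun x : IndefiniteModular.dNeg n' => IndefiniteModular.dTerm m n' ν' τ x)) ∧
    -- the first expression; the poles at `z = 0` of the terms with `n' = 0` cancel in the sum
    (∃ S₀ : ℂ,
      Tendsto
        (fun z : ℂ => ∑ ν' ∈ Finset.range (2 * m + 1), IndefiniteModular.F m 0 0 0 ν' τ z)
        (𝓝[≠] 0) (𝓝 S₀) ∧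
      IndefiniteModular.g m n m (-1 / τ) =
        I * (-1 : ℂ) ^ (m - 1) * τ / (Real.sqrt (2 * m * (2 * m + 1)) : ℂ) *
          (ModularForm.eta (m * τ) ^ 2 * ModularForm.eta (4 * m * τ) ^ 2 /
            ModularForm.eta (2 * m * τ) ^ 5) *
          (S₀ + ∑ n' ∈ Finset.Ico 1 (2 * m), ∑ ν' ∈ Finset.range (2 * m + 1),
            cexp ((Real.pi : ℂ) * I * n * n' / m) *
              IndefiniteModular.F m (-(n' : ℤ)) 0 n' ν' τ 0)) ∧
    -- the second expression
    IndefiniteModular.g m n m (-1 / τ) =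
      -(I * τ / (Real.sqrt (2 * m * (2 * m + 1)) : ℂ)) *
        ((-1 : ℂ) ^ m *
            (∑ n' ∈ Finset.range (2 * m), ∑ ν' ∈ Finset.range (2 * m + 1),
              cexp ((Real.pi : ℂ) * I * n * n' / m) * IndefiniteModular.g m n' ν' τ)
          + ModularForm.eta (m * τ) ^ 2 * ModularForm.eta (4 * m * τ) ^ 2 /
              ModularForm.eta (2 * m * τ) ^ 5 *
            (∑ n' ∈ Finset.range (2 * m), ∑ ν' ∈ Finset.range (2 * m + 1),
              (-1 : ℂ) ^ (m + ν') * cexp ((Real.pi : ℂ) * I * n * n' / m) *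
                IndefiniteModular.qPow τ (1 / (4 * ((m : ℝ) + 1 / 2)) * ((ν' : ℝ) + 1 / 2) ^ 2) *
                IndefiniteModular.vartheta01 (2 * ((m : ℂ) + 1 / 2) * τ)
                  (((ν' : ℂ) + 1 / 2) * τ) *
                IndefiniteModular.D m n' ν' τ)) := by
  have hm' : (0 : ℝ) < m := by exact_mod_cast hm
  have hE := IndefiniteModular.eta_quotient_mul_jacobiTheta hm hτ
  have hg := IndefiniteModular.g_neg_one_div hm hn hτ hE
  refine ⟨fun k hk ν _ => ?_, ⟨_, IndefiniteModular.tendsto_sum_F_zero hm hτ, ?_⟩, ?_⟩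
  · have hk' : (((k : ℕ) : ℤ) : ℝ) < 2 * m := by exact_mod_cast Finset.mem_range.1 hk
    exact ⟨IndefiniteModular.summable_gTerm_gPos hτ hm'.le _ _,
      IndefiniteModular.summable_gTerm_gNeg hτ hm'.le _ _,
      IndefiniteModular.summable_dTerm_dPos hτ hm' (by positivity) hk' (by positivity),
      IndefiniteModular.summable_dTerm_dNeg hτ hm' (by positivity) hk' (by positivity)⟩
  -- Writing m = l + 1 turns -(-1)^m into (-1)^{m-1} without truncated subtraction.
  · obtain ⟨l, rfl⟩ := Nat.exists_eq_succ_of_ne_zero hm.ne'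
    rw [hg, Nat.succ_sub_one, pow_succ]
    ring
  · rw [hg, ← IndefiniteModular.eta_quotient_mul_sum_regValue n hE]
    congr 3
    rw [Finset.range_eq_Ico (2 * m), Finset.sum_eq_sum_Ico_succ_bot (show 0 < 2 * m by omega)]
    congr 1
    · simp
    · refine Finset.sum_congr rfl fun k hk => Finset.sum_congr rfl fun ν _ => ?_
      rw [zero_add, Finset.mem_Ico] at hk
      rw [(IndefiniteModular.tendsto_F hm (by omega) hk.2 ν hτ).1]
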